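/- \textbf{Setting.} An asynchronous message-passing system consists of $n=3f+1$ servers $s_1,\dots,s_n$, a single writer $p_w$ (also the auditor), and an arbitrary set of readers. At most $f$ servers and any number of readers are Byzantine: they may send arbitrary messages, at any time, under their own identity. The writer follows its algorithm but may crash. A process is correct if it is not Byzantine and (for the writer) never crashes. Point-to-point channels are authenticated: a received message was sent before by its stated sender and is received once per sending, and a message from a correct process to a correct process is eventually received. The writer also has a reliable broadcast to the servers: a correct server delivers a message at most once and only if $p_w$ broadcast it before; if $p_w$ is correct, each message it broadcasts is eventually delivered by all correct servers; and if one correct server delivers a message, then all correct servers eventually do (even if $p_w$ crashes). A correct process eventually performs each local action that stays enabled forever. A value $v$ is split into $n$ blocks, the $i$-th encrypted for $s_i$; any $\tau=2f+1$ different blocks of $v$ reconstruct $v$, and invalid blocks are recognized. The register has an initial value $v_0$, with timestamp $0$. \textbf{Algorithm.} \emph{Write$(v)$:} $p_w$ increments $ts$ (initially $0$), broadcasts $(\mathrm{WRITE},ts,[b_1,\dots,b_n])$ with the encrypted blocks of $v$, waits until $n-f$ different servers have acknowledged $ts$, and returns. \emph{Audit:} $p_w$ sends AUDIT\_REQ to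 all servers, waits for logs from $n-f$ different servers, and returns the correctly signed records in the logs collected. \emph{Server $s_i$} (initially $reg\_ts=0$, $val=\{(\text{block } i \text{ of } v_0,\,0)\}$ and $Log=\emptyset$): on delivering $(\mathrm{WRITE},ts,[b_1,\dots,b_n])$ it adds its decrypted block with $ts$ to $val$, sets $reg\_ts\gets\max(reg\_ts,ts)$, and acknowledges $ts$ to $p_w$; on $(\mathrm{TS\_REQ},k)$ from a reader it answers $(\mathrm{TS\_RESP},reg\_ts,k)$; on $(\mathrm{VAL\_REQ},ts,k)$ it waits until $reg\_ts\ge ts$ and answers $(\mathrm{VAL\_RESP},ts,k)$; on $\mathrm{BLOCK\_REQ}$ from reader $p$ with the record $(p,ts,k)$ signed by $p$, it waits until $reg\_ts\ge ts$ and its block $b$ for $ts$ is in $val$, adds the record to $Log$, and answers $(\mathrm{BLOCK\_RESP},b,ts,k)$; on AUDIT\_REQ from $p_w$ it answers with $Log$. \emph{Read} by $p_r$: increment $k$ (initially $0$); set $C[i]\gets\emptyset$ and $B[i]\gets\bot$ for all $i$, and $m\gets\bot$; send $(\mathrm{TS\_REQ},k)$ to all servers; wait until $m\neq\bot$ and at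 least $f+1$ indices $i$ satisfy $m\in C[i]$; send $\mathrm{BLOCK\_REQ}$ with the signed record $(p_r,m,k)$ to all servers; wait until $\mathrm{GetValue}(B)=(v,ts)$ for some $(v,ts)$ with $\mathrm{notOld}(ts)$; return $v$. Here $\mathrm{notOld}(t)$ means $|\{i : C[i]\ne\emptyset,\ \min C[i]\le t\}|\ge 2f+1$, and $\mathrm{GetValue}(B)$ is the pair $(v,ts)$ with the highest $ts$ such that at least $2f+1$ positions $B[i]$ hold the $i$-th block of $v$ with timestamp $ts$. Meanwhile, responses with a sequence number other than the current $k$ are ignored. On $(\mathrm{TS\_RESP},t,k)$ from $s_i$, $p_r$ adds $t$ to $C[i]$ and then, if at least $n-f$ of the sets $C[j]$ are non-empty, sets $m\gets\min\{t\in\bigcup_j C[j] : \mathrm{notOld}(t)\}$ and sends $(\mathrm{VAL\_REQ},m,k)$ to all servers. On $(\mathrm{VAL\_RESP},t,k)$ from $s_i$ it adds $t$ to $C[i]$. On $(\mathrm{BLOCK\_RESP},b,t,k)$ from $s_i$ it sets $B[i]\gets(b,t)$. \textbf{Claim.} In every execution of this system: (1) every read operation invoked by a correct reader terminates, i.e.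 its invocation has a matching response, whether or not the writer crashes; (2) if the writer is correct, every write operation it invokes terminates; (3) consequently the register is wait-free: every operation (read, write or audit) invoked by a correct process has a matching response. -/

import Mathlib

/-!  The auditable register algorithm, as a transition system.

`n` servers, a single writer (who is also the auditor), and readers named by an arbitrary type `R`.
Values written to the register have type `V`.  -/

namespace AuditableRegister

section

/-- The participants: servers `s₁, …, sₙ`, the readers, and the writer. -/
inductive Proc (n : ℕ) (R : Type*) where
  | server (i : Fin n)
  | reader (r : R)
  | writer

/-! ### Blocks -/

/-- The block that server `index` holds for the value `value`: a formal term of the idealized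
dispersal scheme. Clients use blocks only through `IsGetValue` below. -/
structure Block (n : ℕ) (V : Type*) where
  index : Fin n
  value : V

/-- A block encrypted with the public key of the server `recipient`. -/
structure EncBlock (n : ℕ) (V : Type*) where
  recipient : Fin n
  content : Block n V

/-- `GenerateBlocks(v)`: one block per server, the `i`-th one encrypted for server `i`. -/
def generateBlocks {V : Type*} (n : ℕ) (v : V) : Fin n → EncBlock n V :=
  fun i => ⟨i, ⟨i, v⟩⟩

/-- `decrypt`, executed by server `i`: succeeds only on blocks encrypted for `i`. -/
def decrypt {n : ℕ} {V : Type*} (i : Fin n) (e : EncBlock n V) : Option (Block n V) :=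
  if e.recipient = i then some e.content else none

/-! ### Messages -/

/-- The tuple `(reader, ts, nseq)` signed by `signer`. -/
structure SignedRecord (R : Type*) where
  signer : R
  reader : R
  ts : ℤ
  nseq : ℤ

/-- Point-to-point messages. -/
inductive Msg (n : ℕ) (R V : Type*) where
  | tsReq (nseq : ℤ)
  | tsResp (ts nseq : ℤ)
  | valReq (ts nseq : ℤ)
  | valResp (ts nseq : ℤ)
  | blockReq (record : SignedRecord R)
  | blockResp (b : Block n V) (ts nseq : ℤ)
  | writeAck (ts : ℤ)
  | auditReq
  | auditResp (log : List (SignedRecord R))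

/-- A message in transit; channels are authenticated, `src` is the true sender. -/
structure Packet (n : ℕ) (R V : Type*) where
  src : Proc n R
  dst : Proc n R
  msg : Msg n R V

/-- The message `(WRITE, ts, [b₁, …, bₙ])` that the writer passes to reliable broadcast. -/
structure WriteMsg (n : ℕ) (V : Type*) where
  ts : ℤ
  blocks : Fin n → EncBlock n V

/-- A list of messages to be sent, with their destinations. -/
abbrev Out (n : ℕ) (R V : Type*) := List (Proc n R × Msg n R V)

/-- `for i ∈ [1, n] send m to server i`. -/
def toServers {n : ℕ} {R V : Type*} (m : Msg n R V) : Out n R V :=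
  (List.finRange n).map fun i => (Proc.server i, m)

/-- The packets put in transit when `src` sends `out`. -/
def packets {n : ℕ} {R V : Type*} (src : Proc n R) (out : Out n R V) :
    Multiset (Packet n R V) :=
  ((out.map fun x => (⟨src, x.1, x.2⟩ : Packet n R V)) : List (Packet n R V))

/-! ### Local states -/

structure ServerState (n : ℕ) (R V : Type*) where
  regTs : ℤ
  val : List (Block n V × ℤ)
  log : List (SignedRecord R)
  /-- received `VAL_REQ` messages `(reader, ts, nseq)`, not answered yet -/
  pendingVal : Multiset (R × ℤ × ℤ)
  /-- received `BLOCK_REQ` messages, not answered yet -/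
  pendingBlock : Multiset (SignedRecord R)

/-- `collectTs`: the read waits for `f + 1` copies of `min_ts`;
`collectBlocks`: the read waits for enough valid blocks. -/
inductive ReaderPhase where
  | idle
  | collectTs
  | collectBlocks

structure ReaderState (n : ℕ) (V : Type*) where
  phase : ReaderPhase
  nseq : ℤ
  collectedBlocks : Fin n → Option (Block n V × ℤ)
  collectedTs : Fin n → Finset ℤ
  minTs : Option ℤ

inductive WriterPhase where
  | idle
  | writing
  | auditing

structure WriterState (n : ℕ) (R V : Type*) where
  crashed : Prop
  phase : WriterPhase
  ts : ℤ
  blocks : Fin n → Option (EncBlock n V)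
  acks : Fin n → Option ℤ
  /-- `none`: no response yet; `some L`: the log `L` (possibly empty) was received -/
  collectedLog : Fin n → Option (List (SignedRecord R))

/-! ### Code of the servers -/

/-- Server `i` delivers a `WRITE` message from the writer. -/
def serverDeliver {n : ℕ} {R V : Type*} (i : Fin n) (st : ServerState n R V)
    (m : WriteMsg n V) : ServerState n R V × Out n R V :=
  ({ st with
      val := match decrypt i (m.blocks i) with
        | some b => (b, m.ts) :: st.val
        | none => st.val
      regTs := if st.regTs < m.ts then m.ts else st.regTs },
    [(Proc.writer, Msg.writeAck m.ts)])

open Classical in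
/-- A server receives a point-to-point message. `VAL_REQ` and `BLOCK_REQ` are only recorded here:
their answers are subject to a waiting condition and are sent by separate steps. A `BLOCK_REQ` is
accepted only with a record about its sender, signed by its sender. -/
noncomputable def serverReceive {n : ℕ} {R V : Type*} (st : ServerState n R V) :
    Proc n R → Msg n R V → ServerState n R V × Out n R V
  | .reader r, .tsReq nseq => (st, [(.reader r, .tsResp st.regTs nseq)])
  | .reader r, .valReq ts nseq => ({ st with pendingVal := (r, ts, nseq) ::ₘ st.pendingVal }, [])
  | .reader r, .blockReq rc =>
      if rc.signer = r ∧ rc.reader = r then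
        ({ st with pendingBlock := rc ::ₘ st.pendingBlock }, [])
      else (st, [])
  | .writer, .auditReq => (st, [(.writer, .auditResp st.log)])
  | _, _ => (st, [])

/-! ### Code of the readers -/

/-- `notOld(ts)`: `|{i : min(Collected_ts[i]) ≤ ts}| ≥ 2f + 1` (the minimum of `∅` is `⊤`). -/
def NotOld {n : ℕ} (f : ℕ) (C : Fin n → Finset ℤ) (ts : ℤ) : Prop :=
  2 * f + 1 ≤ {i | (C i).min ≤ (ts : WithTop ℤ)}.ncard

open Classical in
/-- `min {ts ∈ Collected_ts | notOld(ts)}`. -/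
noncomputable def leastNotOld {n : ℕ} (f : ℕ) (C : Fin n → Finset ℤ) : Option ℤ :=
  if h : ((Finset.univ.biUnion C).filter (NotOld f C)).Nonempty then
    some (((Finset.univ.biUnion C).filter (NotOld f C)).min' h)
  else none

/-- The collected blocks contain `τ = 2f + 1` different blocks of the value `v` with timestamp
`ts`, the block in position `i` being the one of server `i`. -/
def Reconstructs {n : ℕ} {V : Type*} (f : ℕ) (B : Fin n → Option (Block n V × ℤ))
    (v : V) (ts : ℤ) : Prop :=
  2 * f + 1 ≤ {i | B i = some (⟨i, v⟩, ts)}.ncard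

/-- `GetValue(Collected_blocks) = (v, ts)`: among the pairs that can be reconstructed, one with the
highest timestamp. -/
def IsGetValue {n : ℕ} {V : Type*} (f : ℕ) (B : Fin n → Option (Block n V × ℤ))
    (v : V) (ts : ℤ) : Prop :=
  Reconstructs f B v ts ∧ ∀ v' ts', Reconstructs f B v' ts' → ts' ≤ ts

open Classical in
/-- A reader receives a message. -/
noncomputable def readerReceive {n : ℕ} {R V : Type*} (f : ℕ) (st : ReaderState n V) :
    Proc n R → Msg n R V → ReaderState n V × Out n R V
  | .server i, .tsResp ts num =>
      if num = st.nseq then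
        let C := Function.update st.collectedTs i (insert ts (st.collectedTs i))
        if n - f ≤ {x | C x ≠ ∅}.ncard then
          ({ st with collectedTs := C, minTs := leastNotOld f C },
            match leastNotOld f C with
            | some m => toServers (.valReq m st.nseq)
            | none => [])
        else ({ st with collectedTs := C }, [])
      else (st, [])
  | .server i, .valResp ts num =>
      if num = st.nseq then
        ({ st with
            collectedTs := Function.update st.collectedTs i (insert ts (st.collectedTs i)) }, [])
      else (st, [])
  | .server i, .blockResp b ts num =>
      if num = st.nseq then
        ({ st with
            collectedBlocks := Function.update st.collectedBlocks i (some (b, ts)) }, [])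
      else (st, [])
  | _, _ => (st, [])

/-- Condition on which a read leaves its first wait, with `min_ts = m`. -/
def ReaderState.CanGetBlocks {n : ℕ} {V : Type*} (f : ℕ) (st : ReaderState n V) (m : ℤ) : Prop :=
  st.phase = .collectTs ∧ st.minTs = some m ∧ f + 1 ≤ {i | m ∈ st.collectedTs i}.ncard

/-- Condition on which a read returns `(v, ts)`: `validBlocks(ts) ∧ notOld(ts)`. -/
def ReaderState.CanReturn {n : ℕ} {V : Type*} (f : ℕ) (st : ReaderState n V)
    (v : V) (ts : ℤ) : Prop :=
  st.phase = .collectBlocks ∧ IsGetValue f st.collectedBlocks v ts ∧ NotOld f st.collectedTs ts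

/-! ### Code of the writer -/

open Classical in
/-- The writer receives a message. -/
noncomputable def writerReceive {n : ℕ} {R V : Type*} (st : WriterState n R V) :
    Proc n R → Msg n R V → WriterState n R V
  | .server i, .writeAck t =>
      if st.ts = t then { st with acks := Function.update st.acks i (some t) } else st
  | .server i, .auditResp L =>
      { st with collectedLog := Function.update st.collectedLog i (some L) }
  | _, _ => st

/-- Condition on which a write returns. -/
def WriterState.CanReturnWrite {n : ℕ} {R V : Type*} (f : ℕ) (st : WriterState n R V) : Prop :=
  ¬ st.crashed ∧ st.phase = .writing ∧ n - f ≤ {x | st.acks x = some st.ts}.ncard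

/-- Condition on which an audit returns. -/
def WriterState.CanReturnAudit {n : ℕ} {R V : Type*} (f : ℕ) (st : WriterState n R V) : Prop :=
  ¬ st.crashed ∧ st.phase = .auditing ∧ n - f ≤ {i | st.collectedLog i ≠ none}.ncard

/-- The result of an audit: the correctly signed records found in the collected logs. -/
def WriterState.auditResult {n : ℕ} {R V : Type*} (st : WriterState n R V) :
    Set (SignedRecord R) :=
  {rc | rc.signer = rc.reader ∧ ∃ k L, st.collectedLog k = some L ∧ rc ∈ L}

/-! ### Global states and steps -/

structure State (n : ℕ) (R V : Type*) where
  servers : Fin n → ServerState n R V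
  readers : R → ReaderState n V
  writer : WriterState n R V
  /-- point-to-point messages in transit -/
  net : Multiset (Packet n R V)
  /-- messages that the writer has passed to reliable broadcast -/
  broadcasts : List (WriteMsg n V)
  /-- broadcast messages delivered by each correct server -/
  delivered : Fin n → Set (WriteMsg n V)

/-- The initial state. The register initially holds `v₀`, with timestamp `0`. -/
def initialState (n : ℕ) (R : Type*) {V : Type*} (v₀ : V) : State n R V where
  servers i := ⟨0, [(⟨i, v₀⟩, 0)], [], 0, 0⟩
  readers _ := ⟨.idle, 0, fun _ => none, fun _ => ∅, none⟩
  writer := ⟨False, .idle, 0, fun _ => none, fun _ => none, fun _ => none⟩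
  net := 0
  broadcasts := []
  delivered _ := ∅

/-- The Byzantine servers and the Byzantine readers. -/
structure Faults (n : ℕ) (R : Type*) where
  servers : Set (Fin n)
  readers : Set R

inductive Faults.Byzantine {n : ℕ} {R : Type*} (F : Faults n R) : Proc n R → Prop where
  | server (i : Fin n) (h : i ∈ F.servers) : F.Byzantine (.server i)
  | reader (r : R) (h : r ∈ F.readers) : F.Byzantine (.reader r)

/-- What happens in one step of an execution. -/
inductive Action (n : ℕ) (R V : Type*) where
  | readInvoke (r : R)
  | readBlocks (r : R)
  | readReturn (r : R) (v : V)
  | writeInvoke (v : V)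
  | writeReturn
  | auditInvoke
  | auditReturn (EA : Set (SignedRecord R))
  | crash
  | receive (p : Packet n R V)
  | deliver (i : Fin n) (m : WriteMsg n V)
  | serveVal (i : Fin n) (q : R × ℤ × ℤ)
  | serveBlock (i : Fin n) (rc : SignedRecord R)
  | byzantineSend (p : Packet n R V)
  | skip

open Classical in
/-- The steps of the system. Correct servers, correct readers and the writer (until it crashes)
follow the algorithm; Byzantine ones send arbitrary messages at any time. -/
inductive Step {n : ℕ} {R V : Type*} (f : ℕ) (F : Faults n R) :
    State n R V → Action n R V → State n R V → Prop where
  /-- Invocation of a read: new sequence number, all variables reset, `TS_REQ` to all servers. -/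
  | readInvoke (s : State n R V) (r : R) (hr : r ∉ F.readers)
      (hidle : (s.readers r).phase = .idle) :
      Step f F s (.readInvoke r)
        { s with
          readers := Function.update s.readers r
            ⟨.collectTs, (s.readers r).nseq + 1, fun _ => none, fun _ => ∅, none⟩
          net := s.net + packets (.reader r) (toServers (.tsReq ((s.readers r).nseq + 1))) }
  /-- End of the first wait of a read: signed `BLOCK_REQ` to all servers. -/
  | readBlocks (s : State n R V) (r : R) (m : ℤ) (hr : r ∉ F.readers)
      (h : (s.readers r).CanGetBlocks f m) :
      Step f F s (.readBlocks r)
        { s with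
          readers := Function.update s.readers r { s.readers r with phase := .collectBlocks }
          net := s.net + packets (.reader r)
            (toServers (.blockReq ⟨r, r, m, (s.readers r).nseq⟩)) }
  /-- Response of a read. -/
  | readReturn (s : State n R V) (r : R) (v : V) (ts : ℤ) (hr : r ∉ F.readers)
      (h : (s.readers r).CanReturn f v ts) :
      Step f F s (.readReturn r v)
        { s with readers := Function.update s.readers r { s.readers r with phase := .idle } }
  /-- Invocation of a write: new timestamp, broadcast of the blocks. -/
  | writeInvoke (s : State n R V) (v : V) (hw : ¬ s.writer.crashed)
      (hidle : s.writer.phase = .idle) :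
      Step f F s (.writeInvoke v)
        { s with
          writer := { s.writer with
            phase := .writing
            ts := s.writer.ts + 1
            blocks := fun i => some (generateBlocks n v i) }
          broadcasts := ⟨s.writer.ts + 1, generateBlocks n v⟩ :: s.broadcasts }
  /-- Response of a write. -/
  | writeReturn (s : State n R V) (h : s.writer.CanReturnWrite f) :
      Step f F s .writeReturn { s with writer := { s.writer with phase := .idle } }
  /-- Invocation of an audit: collected logs reset, `AUDIT_REQ` to all servers. -/
  | auditInvoke (s : State n R V) (hw : ¬ s.writer.crashed)
      (hidle : s.writer.phase = .idle) :
      Step f F s .auditInvoke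
        { s with
          writer := { s.writer with phase := .auditing, collectedLog := fun _ => none }
          net := s.net + packets .writer (toServers .auditReq) }
  /-- Response of an audit. -/
  | auditReturn (s : State n R V) (h : s.writer.CanReturnAudit f) :
      Step f F s (.auditReturn s.writer.auditResult)
        { s with writer := { s.writer with phase := .idle } }
  /-- The writer crashes. -/
  | crash (s : State n R V) :
      Step f F s .crash { s with writer := { s.writer with crashed := True } }
  /-- A correct server receives a point-to-point message. -/
  | receiveServer (s : State n R V) (i : Fin n) (src : Proc n R) (m : Msg n R V)
      (rest : Multiset (Packet n R V)) (hi : i ∉ F.servers)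
      (hnet : s.net = ⟨src, .server i, m⟩ ::ₘ rest) :
      Step f F s (.receive ⟨src, .server i, m⟩)
        { s with
          servers := Function.update s.servers i (serverReceive (s.servers i) src m).1
          net := rest + packets (.server i) (serverReceive (s.servers i) src m).2 }
  /-- A correct reader receives a message. -/
  | receiveReader (s : State n R V) (r : R) (src : Proc n R) (m : Msg n R V)
      (rest : Multiset (Packet n R V)) (hr : r ∉ F.readers)
      (hnet : s.net = ⟨src, .reader r, m⟩ ::ₘ rest) :
      Step f F s (.receive ⟨src, .reader r, m⟩)
        { s with
          readers := Function.update s.readers r (readerReceive f (s.readers r) src m).1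
          net := rest + packets (.reader r) (readerReceive f (s.readers r) src m).2 }
  /-- The writer receives a message. -/
  | receiveWriter (s : State n R V) (src : Proc n R) (m : Msg n R V)
      (rest : Multiset (Packet n R V)) (hw : ¬ s.writer.crashed)
      (hnet : s.net = ⟨src, .writer, m⟩ ::ₘ rest) :
      Step f F s (.receive ⟨src, .writer, m⟩)
        { s with writer := writerReceive s.writer src m, net := rest }
  /-- A Byzantine participant receives a message. -/
  | receiveByzantine (s : State n R V) (p : Packet n R V) (rest : Multiset (Packet n R V))
      (hp : F.Byzantine p.dst) (hnet : s.net = p ::ₘ rest) :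
      Step f F s (.receive p) { s with net := rest }
  /-- A correct server delivers, at most once, a message broadcast by the writer. -/
  | deliver (s : State n R V) (i : Fin n) (m : WriteMsg n V) (hi : i ∉ F.servers)
      (hb : m ∈ s.broadcasts) (hnew : m ∉ s.delivered i) :
      Step f F s (.deliver i m)
        { s with
          servers := Function.update s.servers i (serverDeliver i (s.servers i) m).1
          net := s.net + packets (.server i) (serverDeliver i (s.servers i) m).2
          delivered := Function.update s.delivered i (insert m (s.delivered i)) }
  /-- A correct server with `reg_ts ≥ ts` answers a pending `VAL_REQ`. -/
  | serveVal (s : State n R V) (i : Fin n) (r : R) (ts nseq : ℤ)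
      (rest : Multiset (R × ℤ × ℤ)) (hi : i ∉ F.servers)
      (hq : (s.servers i).pendingVal = (r, ts, nseq) ::ₘ rest)
      (hts : ts ≤ (s.servers i).regTs) :
      Step f F s (.serveVal i (r, ts, nseq))
        { s with
          servers := Function.update s.servers i { s.servers i with pendingVal := rest }
          net := s.net + packets (.server i) [(.reader r, .valResp ts nseq)] }
  /-- A correct server with `reg_ts ≥ ts` that has its block for the timestamp `ts` logs a pending
  `BLOCK_REQ` and answers it. -/
  | serveBlock (s : State n R V) (i : Fin n) (rc : SignedRecord R) (b : Block n V)
      (rest : Multiset (SignedRecord R)) (hi : i ∉ F.servers)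
      (hq : (s.servers i).pendingBlock = rc ::ₘ rest)
      (hts : rc.ts ≤ (s.servers i).regTs) (hb : (b, rc.ts) ∈ (s.servers i).val) :
      Step f F s (.serveBlock i rc)
        { s with
          servers := Function.update s.servers i
            { s.servers i with pendingBlock := rest, log := rc :: (s.servers i).log }
          net := s.net + packets (.server i)
            [(.reader rc.reader, .blockResp b rc.ts rc.nseq)] }
  /-- A Byzantine participant sends an arbitrary message under its own name. -/
  | byzantineSend (s : State n R V) (p : Packet n R V) (hp : F.Byzantine p.src) :
      Step f F s (.byzantineSend p) { s with net := p ::ₘ s.net }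
  | skip (s : State n R V) : Step f F s .skip s

/-! ### Executions -/

/-- An infinite run of the system from the initial state (finite runs are padded with `skip`). -/
structure Execution {n : ℕ} {R V : Type*} (f : ℕ) (F : Faults n R) (v₀ : V) where
  state : ℕ → State n R V
  action : ℕ → Action n R V
  start : state 0 = initialState n R v₀
  step : ∀ t, Step f F (state t) (action t) (state (t + 1))

/-- The correct participants: those that are not Byzantine and, for the writer, never crash. -/
def Execution.Correct {n : ℕ} {R V : Type*} {f : ℕ} {F : Faults n R} {v₀ : V}
    (E : Execution f F v₀) : Proc n R → Prop
  | .server i => i ∉ F.servers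
  | .reader r => r ∉ F.readers
  | .writer => ∀ t, E.action t ≠ .crash

/-- The local actions that a participant has to perform by itself once they are enabled. -/
inductive Task (n : ℕ) (R : Type*) where
  | readBlocks (r : R)
  | readReturn (r : R)
  | writeReturn
  | auditReturn
  | serveVal (i : Fin n) (q : R × ℤ × ℤ)
  | serveBlock (i : Fin n) (rc : SignedRecord R)

def Task.owner {n : ℕ} {R : Type*} : Task n R → Proc n R
  | .readBlocks r => .reader r
  | .readReturn r => .reader r
  | .writeReturn => .writer
  | .auditReturn => .writer
  | .serveVal i _ => .server i
  | .serveBlock i _ => .server i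

def Task.Enabled {n : ℕ} {R V : Type*} (f : ℕ) (s : State n R V) : Task n R → Prop
  | .readBlocks r => ∃ m, (s.readers r).CanGetBlocks f m
  | .readReturn r => ∃ v ts, (s.readers r).CanReturn f v ts
  | .writeReturn => s.writer.CanReturnWrite f
  | .auditReturn => s.writer.CanReturnAudit f
  | .serveVal i q => q ∈ (s.servers i).pendingVal ∧ q.2.1 ≤ (s.servers i).regTs
  | .serveBlock i rc => rc ∈ (s.servers i).pendingBlock ∧ rc.ts ≤ (s.servers i).regTs ∧
      ∃ b, (b, rc.ts) ∈ (s.servers i).val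

/-- The task that an action performs, if any. -/
def Action.task {n : ℕ} {R V : Type*} : Action n R V → Option (Task n R)
  | .readBlocks r => some (.readBlocks r)
  | .readReturn r _ => some (.readReturn r)
  | .writeReturn => some .writeReturn
  | .auditReturn _ => some .auditReturn
  | .serveVal i q => some (.serveVal i q)
  | .serveBlock i rc => some (.serveBlock i rc)
  | _ => none

/-- The liveness guarantees of the asynchronous system: those of the channels, those of the
reliable broadcast, and that correct participants keep executing their code. No bound on delays. -/
structure Execution.Admissible {n : ℕ} {R V : Type*} {f : ℕ} {F : Faults n R} {v₀ : V}
    (E : Execution f F v₀) : Prop where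
  /-- Reliable delivery: a message from a correct participant to a correct one is received. -/
  reliable_delivery : ∀ t p, p ∈ (E.state t).net → E.Correct p.src → E.Correct p.dst →
    ∃ t', t ≤ t' ∧ E.action t' = .receive p
  /-- Reliable broadcast, Termination-1: if the writer is correct, its messages are delivered by
  all correct servers. -/
  termination_one : E.Correct .writer → ∀ t m, m ∈ (E.state t).broadcasts →
    ∀ i, E.Correct (.server i) → ∃ t', E.action t' = .deliver i m
  /-- Reliable broadcast, Termination-2: a message delivered by one correct server is delivered by
  all of them, even if the writer crashes. -/
  termination_two : ∀ t i m, E.Correct (.server i) → E.action t = .deliver i m →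
    ∀ j, E.Correct (.server j) → ∃ t', E.action t' = .deliver j m
  /-- A local action of a correct participant that stays enabled forever is performed. -/
  progress : ∀ a : Task n R, E.Correct a.owner → ∀ t,
    (∀ t', t ≤ t' → a.Enabled f (E.state t')) → ∃ t', t ≤ t' ∧ (E.action t').task = some a

/-! ### Operations and wait-freedom -/

inductive OpKind where
  | read
  | write
  | audit

/-- The participant and the kind of the operation whose invocation event is this action. -/
def Action.invocation {n : ℕ} {R V : Type*} : Action n R V → Option (Proc n R × OpKind)
  | .readInvoke r => some (.reader r, .read)
  | .writeInvoke _ => some (.writer, .write)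
  | .auditInvoke => some (.writer, .audit)
  | _ => none

/-- The participant and the kind of the operation whose response event is this action. -/
def Action.response {n : ℕ} {R V : Type*} : Action n R V → Option (Proc n R × OpKind)
  | .readReturn r _ => some (.reader r, .read)
  | .writeReturn => some (.writer, .write)
  | .auditReturn _ => some (.writer, .audit)
  | _ => none

/-- The operation of kind `k` invoked by `p` at time `t` has a matching response: a later response
event of `p`, of the same kind, with no invocation or response event of `p` in between. -/
def Execution.HasMatchingResponse {n : ℕ} {R V : Type*} {f : ℕ} {F : Faults n R} {v₀ : V}
    (E : Execution f F v₀) (p : Proc n R) (k : OpKind) (t : ℕ) : Prop :=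
  ∃ t', t < t' ∧ (E.action t').response = some (p, k) ∧
    ∀ u, t < u → u < t' → ∀ k',
      (E.action u).invocation ≠ some (p, k') ∧ (E.action u).response ≠ some (p, k')

/-- Every operation invoked by a correct participant has a matching response. -/
def Execution.WaitFree {n : ℕ} {R V : Type*} {f : ℕ} {F : Faults n R} {v₀ : V}
    (E : Execution f F v₀) : Prop :=
  ∀ t p k, E.Correct p → (E.action t).invocation = some (p, k) → E.HasMatchingResponse p k t

end

end AuditableRegister

namespace AuditableRegister

open Filter

variable {n f : ℕ} {R V : Type*} {F : Faults n R} {v₀ : V} {s s' : State n R V}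
  {a : Action n R V}

/-! The danger is that a read waits for a timestamp that the correct servers never reach, because
Byzantine servers invented it or because the writer crashed during a write.

The writer is sequential: it starts a write only when the previous one has `n - f = 2f + 1`
acknowledgements, at least one of them from a correct server that delivered it. So a nonnegative
timestamp `x` bounded by the `regTs` of one correct server is `0` or was delivered by some correct
server (`WriteInvariant.delivered_of_le_regTs`). Termination-2 then brings `x` and its block to all
correct servers, whether or not the writer crashes (`Execution.Admissible.eventually_block`).

First wait of a read. The collected sets only grow and `NotOld` is monotone in them, so `minTs`,
once defined, never increases. It is nonnegative, because `NotOld` provides a correct server with a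
collected timestamp below it. Hence it settles at a least value `M`. This `M` is bounded by the
`regTs` of a correct server, and `VAL_REQ` was sent for it, so all correct servers, at least `2f +
1` of them, answer with `M` (`Execution.Admissible.exists_readBlocks`).

Second wait. The requested timestamp `μ` is held in `f + 1` sets, hence was reached by a correct
server, and all correct servers answer with a block. Every block that a correct server sends for
this read has timestamp `μ` (`Execution.Reading.collectedBlocks_ts`), and these blocks encode one
value. They reconstruct it, and no other timestamp can be reconstructed, since `2f + 1` positions
include a correct one (`Execution.exists_isGetValue`). `NotOld` for `μ` persists from the first
wait.

Writes and audits only need the answers of the correct servers. In all three cases a missing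
response would freeze the operation, the answers would accumulate, and the return would stay enabled
forever, against `progress`. -/

theorem mem_packets {src : Proc n R} {out : Out n R V} {p : Packet n R V} :
    p ∈ packets src out ↔ p.src = src ∧ (p.dst, p.msg) ∈ out := by
  rcases p with ⟨src', dst, msg⟩
  simp only [packets, Multiset.mem_coe, List.mem_map, Prod.exists, Packet.mk.injEq]
  grind

theorem mem_toServers {d : Proc n R} {m m' : Msg n R V} :
    (d, m') ∈ toServers m ↔ m' = m ∧ ∃ i, d = .server i := by
  simp only [toServers, List.mem_map, List.mem_finRange, true_and, Prod.mk.injEq]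
  grind

/-! ### How a step changes each component -/

theorem Step.reader_cases (h : Step f F s a s') (r : R) :
    s'.readers r = s.readers r ∨
    (a = .readInvoke r ∧ s'.readers r =
      ⟨.collectTs, (s.readers r).nseq + 1, fun _ => none, fun _ => ∅, none⟩) ∨
    (a = .readBlocks r ∧ (∃ m, (s.readers r).CanGetBlocks f m) ∧
      s'.readers r = { s.readers r with phase := .collectBlocks }) ∨
    (∃ v, a = .readReturn r v ∧ s'.readers r = { s.readers r with phase := .idle }) ∨
    (∃ src m, a = .receive ⟨src, .reader r, m⟩ ∧ ⟨src, .reader r, m⟩ ∈ s.net ∧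
      s'.readers r = (readerReceive f (s.readers r) src m).1) := by
  classical
  cases h with
  | readInvoke r' _ _ | readBlocks r' _ _ _ | readReturn r' _ _ _ _ =>
    by_cases e : r = r'
    · subst e; simp; try exact .inr ⟨_, ‹_›⟩
    · left; simp [Function.update_of_ne e]
  | receiveReader r' src m rest hr hnet =>
    by_cases e : r = r'
    · subst e
      right; right; right; right
      exact ⟨src, m, rfl, by simp [hnet], by simp⟩
    · left; simp [Function.update_of_ne e]
  | _ => left; rfl

theorem Step.server_cases (h : Step f F s a s') (i : Fin n) :
    (s'.servers i = s.servers i ∧ s'.delivered i = s.delivered i) ∨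
    (∃ src m, a = .receive ⟨src, .server i, m⟩ ∧ ⟨src, .server i, m⟩ ∈ s.net ∧
      s'.servers i = (serverReceive (s.servers i) src m).1 ∧ s'.delivered i = s.delivered i) ∨
    (∃ m, a = .deliver i m ∧ m ∈ s.broadcasts ∧
      s'.servers i = (serverDeliver i (s.servers i) m).1 ∧
      s'.delivered i = insert m (s.delivered i)) ∨
    (∃ q rest, a = .serveVal i q ∧ (s.servers i).pendingVal = q ::ₘ rest ∧
      s'.servers i = { s.servers i with pendingVal := rest } ∧
      s'.delivered i = s.delivered i) ∨
    (∃ rc rest, a = .serveBlock i rc ∧ (s.servers i).pendingBlock = rc ::ₘ rest ∧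
      s'.servers i = { s.servers i with pendingBlock := rest, log := rc :: (s.servers i).log } ∧
      s'.delivered i = s.delivered i) := by
  classical
  cases h with
  | receiveServer i' src m rest hi hnet =>
    by_cases e : i = i'
    · subst e
      right; left
      exact ⟨src, m, rfl, by simp [hnet], by simp⟩
    · left; simp [Function.update_of_ne e]
  | deliver i' m hi hb hnew =>
    by_cases e : i = i'
    · subst e; simp [hb]
    · left; simp [Function.update_of_ne e]
  | serveVal i' r ts k rest hi hq hts =>
    by_cases e : i = i'
    · subst e
      right; right; right; left
      exact ⟨(r, ts, k), rest, rfl, hq, by simp⟩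
    · left; simp [Function.update_of_ne e]
  | serveBlock i' rc b rest hi hq hts hb =>
    by_cases e : i = i'
    · subst e
      right; right; right; right
      exact ⟨rc, rest, rfl, hq, by simp⟩
    · left; simp [Function.update_of_ne e]
  | _ => left; exact ⟨rfl, rfl⟩

theorem Step.writer_cases (h : Step f F s a s') :
    (s'.writer = s.writer ∧ s'.broadcasts = s.broadcasts) ∨
    (∃ v, a = .writeInvoke v ∧ s.writer.phase = .idle ∧
      s'.writer = { s.writer with
        phase := .writing
        ts := s.writer.ts + 1
        blocks := fun i => some (generateBlocks n v i) } ∧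
      s'.broadcasts = ⟨s.writer.ts + 1, generateBlocks n v⟩ :: s.broadcasts) ∨
    (a = .writeReturn ∧ s.writer.CanReturnWrite f ∧
      s'.writer = { s.writer with phase := .idle } ∧ s'.broadcasts = s.broadcasts) ∨
    (a = .auditInvoke ∧ s.writer.phase = .idle ∧
      s'.writer = { s.writer with phase := .auditing, collectedLog := fun _ => none } ∧
      s'.broadcasts = s.broadcasts) ∨
    (∃ EA, a = .auditReturn EA ∧ s.writer.CanReturnAudit f ∧
      s'.writer = { s.writer with phase := .idle } ∧ s'.broadcasts = s.broadcasts) ∨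
    (a = .crash ∧ s'.writer = { s.writer with crashed := True } ∧
      s'.broadcasts = s.broadcasts) ∨
    (∃ src m, a = .receive ⟨src, .writer, m⟩ ∧ ⟨src, .writer, m⟩ ∈ s.net ∧
      s'.writer = writerReceive s.writer src m ∧ s'.broadcasts = s.broadcasts) := by
  cases h with
  | receiveWriter src m rest hw hnet =>
    iterate 6 right
    exact ⟨src, m, rfl, by simp [hnet], rfl, rfl⟩
  | writeInvoke | writeReturn | auditInvoke | auditReturn | crash => simp_all
  | _ => left; exact ⟨rfl, rfl⟩

theorem Step.net_from_reader (h : Step f F s a s') {r : R} (hr : r ∉ F.readers) {d : Proc n R}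
    {msg : Msg n R V} (hp : ⟨.reader r, d, msg⟩ ∈ s'.net) :
    ⟨.reader r, d, msg⟩ ∈ s.net ∨
    (a = .readInvoke r ∧ msg = .tsReq ((s.readers r).nseq + 1)) ∨
    (a = .readBlocks r ∧ ∃ m, (s.readers r).CanGetBlocks f m ∧
      msg = .blockReq ⟨r, r, m, (s.readers r).nseq⟩) ∨
    (∃ src m, a = .receive ⟨src, .reader r, m⟩ ∧
      (d, msg) ∈ (readerReceive f (s.readers r) src m).2) := by
  cases h with
  | byzantineSend p hb =>
    rcases Multiset.mem_cons.1 hp with rfl | hp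
    · cases hb; contradiction
    · exact .inl hp
  | _ =>
    simp_all only [Multiset.mem_add, Multiset.mem_cons, mem_packets, mem_toServers,
      Proc.reader.injEq, reduceCtorEq, false_and, or_false]
    try grind

theorem Step.net_from_server (h : Step f F s a s') {i : Fin n} (hi : i ∉ F.servers)
    {d : Proc n R} {msg : Msg n R V} (hp : ⟨.server i, d, msg⟩ ∈ s'.net) :
    ⟨.server i, d, msg⟩ ∈ s.net ∨
    (∃ src m, a = .receive ⟨src, .server i, m⟩ ∧
      (d, msg) ∈ (serverReceive (s.servers i) src m).2) ∨
    (∃ m, a = .deliver i m ∧ d = .writer ∧ msg = .writeAck m.ts) ∨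
    (∃ r ts k, a = .serveVal i (r, ts, k) ∧ (r, ts, k) ∈ (s.servers i).pendingVal ∧
      ts ≤ (s.servers i).regTs ∧ d = .reader r ∧ msg = .valResp ts k) ∨
    (∃ rc b, a = .serveBlock i rc ∧ rc ∈ (s.servers i).pendingBlock ∧
      (b, rc.ts) ∈ (s.servers i).val ∧ d = .reader rc.reader ∧
      msg = .blockResp b rc.ts rc.nseq) := by
  cases h with
  | byzantineSend p hb =>
    rcases Multiset.mem_cons.1 hp with rfl | hp
    · cases hb; contradiction
    · exact .inl hp
  | receiveServer | deliver | serveVal | serveBlock =>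
    simp_all only [Multiset.mem_add, Multiset.mem_cons, mem_packets, serverDeliver,
      List.mem_singleton, Prod.mk.injEq, Proc.server.injEq]
    grind
  | _ =>
    simp_all only [Multiset.mem_add, Multiset.mem_cons, mem_packets,
      reduceCtorEq, false_and, or_false]
    try grind

/-! ### Monotonicity of the servers -/

@[simp]
theorem serverReceive_regTs (st : ServerState n R V) (src : Proc n R) (m : Msg n R V) :
    (serverReceive st src m).1.regTs = st.regTs := by
  unfold serverReceive; split <;> try split
  all_goals rfl

@[simp]
theorem serverReceive_val (st : ServerState n R V) (src : Proc n R) (m : Msg n R V) :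
    (serverReceive st src m).1.val = st.val := by
  unfold serverReceive; split <;> try split
  all_goals rfl

theorem Step.delivered_mono (h : Step f F s a s') (i : Fin n) :
    s.delivered i ⊆ s'.delivered i := by
  rcases h.server_cases i with ⟨_, h⟩ | ⟨_, _, _, _, _, h⟩ | ⟨_, _, _, _, h⟩ | ⟨_, _, _, _, _, h⟩ |
    ⟨_, _, _, _, _, h⟩ <;> rw [h]
  exact Set.subset_insert _ _

theorem Step.regTs_mono (h : Step f F s a s') (i : Fin n) :
    (s.servers i).regTs ≤ (s'.servers i).regTs := by
  rcases h.server_cases i with ⟨h, _⟩ | ⟨_, _, _, _, h, _⟩ | ⟨_, _, _, h, _⟩ | ⟨_, _, _, _, h, _⟩ |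
    ⟨_, _, _, _, h, _⟩ <;> rw [h]
  · simp
  · simp only [serverDeliver]; split <;> omega

theorem Step.broadcasts_mono (h : Step f F s a s') {m : WriteMsg n V} (hm : m ∈ s.broadcasts) :
    m ∈ s'.broadcasts := by
  rcases h.writer_cases with ⟨_, h⟩ | ⟨_, _, _, _, h⟩ | ⟨_, _, _, h⟩ | ⟨_, _, _, h⟩ |
    ⟨_, _, _, _, h⟩ | ⟨_, _, h⟩ | ⟨_, _, _, _, _, h⟩ <;> rw [h] <;> simp [hm]

/-! ### Quorums -/

theorem exists_correct_of_lt_ncard (hF : F.servers.ncard ≤ f) {A : Set (Fin n)}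
    (hA : f + 1 ≤ A.ncard) : ∃ i ∈ A, i ∉ F.servers := by
  by_contra! h
  have := Set.ncard_le_ncard (s := A) (t := F.servers) h (Set.toFinite _)
  omega

theorem le_ncard_of_correct (hn : n = 3 * f + 1) (hF : F.servers.ncard ≤ f) {A : Set (Fin n)}
    (hA : ∀ i, i ∉ F.servers → i ∈ A) : 2 * f + 1 ≤ A.ncard := by
  have h1 := Set.ncard_le_ncard (s := F.serversᶜ) (t := A) hA (Set.toFinite _)
  have h2 := Set.ncard_add_ncard_compl F.servers
  rw [Nat.card_eq_fintype_card, Fintype.card_fin] at h2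
  omega

/-! ### Invariants of the writes -/

/-- The field `completed` is the one used by the liveness argument. It leaves out only the timestamp
of a write in progress, the one that a crash may leave undelivered. The acknowledgement fields serve
to prove it, and `broadcast_unique` makes blocks with equal timestamps agree. -/
structure WriteInvariant (F : Faults n R) (v₀ : V) (s : State n R V) : Prop where
  ts_nonneg : 0 ≤ s.writer.ts
  broadcast : ∀ m ∈ s.broadcasts, 1 ≤ m.ts ∧ m.ts ≤ s.writer.ts ∧
    ∃ v, m.blocks = generateBlocks n v
  broadcast_unique : ∀ m ∈ s.broadcasts, ∀ m' ∈ s.broadcasts, m.ts = m'.ts → m = m'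
  delivered : ∀ i, ∀ m ∈ s.delivered i, m ∈ s.broadcasts
  le_regTs : ∀ i, ∀ m ∈ s.delivered i, m.ts ≤ (s.servers i).regTs
  regTs : ∀ i, (s.servers i).regTs = 0 ∨ ∃ m ∈ s.delivered i, m.ts = (s.servers i).regTs
  val : ∀ i b t, (b, t) ∈ (s.servers i).val ↔
    (t = 0 ∧ b = ⟨i, v₀⟩) ∨ ∃ m ∈ s.delivered i, m.ts = t ∧ b = (m.blocks i).content
  ack_sent : ∀ i, i ∉ F.servers → ∀ d t, ⟨.server i, d, .writeAck t⟩ ∈ s.net →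
    ∃ m ∈ s.delivered i, m.ts = t
  ack_received : ∀ i, i ∉ F.servers → ∀ t, s.writer.acks i = some t →
    ∃ m ∈ s.delivered i, m.ts = t
  completed : ∀ t, 1 ≤ t → t ≤ s.writer.ts → (t = s.writer.ts → s.writer.phase ≠ .writing) →
    ∃ i, i ∉ F.servers ∧ ∃ m ∈ s.delivered i, m.ts = t

theorem writeInvariant_initialState : WriteInvariant F v₀ (initialState n R v₀) := by
  constructor <;> simp [initialState]
  · grind
  · intros; omega

theorem writerReceive_spec (st : WriterState n R V) (src : Proc n R) (m : Msg n R V) :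
    (writerReceive st src m).ts = st.ts ∧ (writerReceive st src m).phase = st.phase ∧
    (writerReceive st src m).crashed = st.crashed ∧
    ∀ i, (writerReceive st src m).acks i = st.acks i ∨
      src = .server i ∧ m = .writeAck st.ts ∧ (writerReceive st src m).acks i = some st.ts := by
  unfold writerReceive
  split <;> (try split) <;> simp
  intro i
  simp only [Function.update_apply]
  grind

theorem WriteInvariant.step (hn : n = 3 * f + 1) (hF : F.servers.ncard ≤ f)
    (I : WriteInvariant F v₀ s) (h : Step f F s a s') : WriteInvariant F v₀ s' := by
  have hlt : ∀ m ∈ s.broadcasts, m.ts ≠ s.writer.ts + 1 := fun m hm => by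
    have := (I.broadcast m hm).2.1; omega
  have hdel : ∀ i, ∀ m ∈ s'.delivered i, m ∈ s.broadcasts := by
    intro i m hm
    rcases h.server_cases i with ⟨_, h'⟩ | ⟨_, _, _, _, _, h'⟩ | ⟨m', _, hb, _, h'⟩ |
      ⟨_, _, _, _, _, h'⟩ | ⟨_, _, _, _, _, h'⟩ <;> rw [h'] at hm
    · exact I.delivered i m hm
    · exact I.delivered i m hm
    · rcases hm with rfl | hm
      exacts [hb, I.delivered i m hm]
    · exact I.delivered i m hm
    · exact I.delivered i m hm
  have hdec : ∀ i, ∀ m ∈ s.broadcasts,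
      decrypt i (m.blocks i) = some (m.blocks i).content := by
    intro i m hm
    obtain ⟨-, -, v, hv⟩ := I.broadcast m hm
    simp [hv, decrypt, generateBlocks]
  have hmono : ∀ {i t}, (∃ m ∈ s.delivered i, m.ts = t) → ∃ m ∈ s'.delivered i, m.ts = t :=
    fun ⟨m, hm, e⟩ => ⟨m, h.delivered_mono _ hm, e⟩
  constructor
  case ts_nonneg =>
    have := I.ts_nonneg
    rcases h.writer_cases with ⟨e, _⟩ | ⟨_, _, _, e, _⟩ | ⟨_, _, e, _⟩ | ⟨_, _, e, _⟩ |
      ⟨_, _, _, e, _⟩ | ⟨_, e, _⟩ | ⟨_, _, _, _, e, _⟩ <;> rw [e] <;>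
      (try simp [writerReceive_spec]) <;> omega
  case broadcast =>
    have := I.broadcast
    have := I.ts_nonneg
    rcases h.writer_cases with ⟨e, e'⟩ | ⟨_, _, _, e, e'⟩ | ⟨_, _, e, e'⟩ | ⟨_, _, e, e'⟩ |
      ⟨_, _, _, e, e'⟩ | ⟨_, e, e'⟩ | ⟨_, _, _, _, e, e'⟩ <;> rw [e, e'] <;>
      (try simp [writerReceive_spec]) <;> try assumption
    refine ⟨by omega, fun m hm => ?_⟩
    obtain ⟨h1, h2, h3⟩ := I.broadcast m hm
    exact ⟨h1, by omega, h3⟩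
  case broadcast_unique =>
    have := I.broadcast_unique
    rcases h.writer_cases with ⟨e, e'⟩ | ⟨_, _, _, e, e'⟩ | ⟨_, _, e, e'⟩ | ⟨_, _, e, e'⟩ |
      ⟨_, _, _, e, e'⟩ | ⟨_, e, e'⟩ | ⟨_, _, _, _, e, e'⟩ <;> rw [e'] <;> try assumption
    intro m hm m' hm' hts
    rcases List.mem_cons.1 hm with rfl | hm <;> rcases List.mem_cons.1 hm' with rfl | hm'
    · rfl
    · exact absurd hts.symm (hlt _ hm')
    · exact absurd hts (hlt _ hm)
    · exact this m hm m' hm' hts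
  case delivered => exact fun i m hm => h.broadcasts_mono (hdel i m hm)
  case le_regTs =>
    intro i m hm
    have := I.le_regTs i m
    rcases h.server_cases i with ⟨h, h'⟩ | ⟨_, _, _, _, h, h'⟩ | ⟨m', _, hb, h, h'⟩ |
      ⟨_, _, _, _, h, h'⟩ | ⟨_, _, _, _, h, h'⟩ <;> rw [h'] at hm <;> rw [h] <;>
      (try simp only [serverReceive_regTs, serverDeliver]) <;> try exact this hm
    rcases hm with rfl | hm
    · split <;> omega
    · have := this hm
      split <;> omega
  case regTs =>
    intro i
    have := I.regTs i
    rcases h.server_cases i with ⟨h, h'⟩ | ⟨_, _, _, _, h, h'⟩ | ⟨m', _, hb, h, h'⟩ |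
      ⟨_, _, _, _, h, h'⟩ | ⟨_, _, _, _, h, h'⟩ <;> rw [h', h] <;>
      (try simp only [serverReceive_regTs, serverDeliver]) <;> try exact this
    split
    · exact .inr ⟨m', Set.mem_insert _ _, rfl⟩
    · exact this.imp_right fun ⟨m, hm, e⟩ => ⟨m, Set.mem_insert_of_mem _ hm, e⟩
  case val =>
    intro i b t
    have := I.val i b t
    rcases h.server_cases i with ⟨h, h'⟩ | ⟨_, _, _, _, h, h'⟩ | ⟨m', _, hb, h, h'⟩ |
      ⟨_, _, _, _, h, h'⟩ | ⟨_, _, _, _, h, h'⟩ <;> rw [h', h] <;>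
      (try simp only [serverReceive_val, serverDeliver]) <;> try exact this
    simp only [hdec i m' hb, List.mem_cons, this, Prod.mk.injEq, Set.mem_insert_iff]
    grind
  case ack_sent =>
    intro i hi d t hp
    rcases h.net_from_server hi hp with hp | ⟨src, m, -, hm⟩ | ⟨m, rfl, -, hm⟩ |
      ⟨r, ts, k, -, -, -, -, hm⟩ | ⟨_, _, _, _, _, _, hm⟩
    · exact hmono (I.ack_sent i hi d t hp)
    · unfold serverReceive at hm
      grind
    · cases hm
      cases h
      exact ⟨m, by simp, rfl⟩
    · cases hm
    · cases hm
  case ack_received =>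
    intro i hi t ht
    apply hmono
    rcases h.writer_cases with ⟨e, _⟩ | ⟨_, _, _, e, _⟩ | ⟨_, _, e, _⟩ | ⟨_, _, e, _⟩ |
      ⟨_, _, _, e, _⟩ | ⟨_, e, _⟩ | ⟨src, m, _, hp, e, _⟩ <;> rw [e] at ht <;>
      try exact I.ack_received i hi t ht
    rcases (writerReceive_spec s.writer src m).2.2.2 i with e' | ⟨rfl, rfl, e'⟩ <;>
      rw [e'] at ht
    · exact I.ack_received i hi t ht
    · cases ht
      exact I.ack_sent i hi _ _ hp
  case completed =>
    intro t ht1 ht2 ht3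
    suffices ∃ i, i ∉ F.servers ∧ ∃ m ∈ s.delivered i, m.ts = t from
      this.imp fun i hi => ⟨hi.1, hmono hi.2⟩
    rcases h.writer_cases with ⟨e, _⟩ | ⟨_, _, hid, e, _⟩ | ⟨_, hc, e, _⟩ | ⟨_, hid, e, _⟩ |
      ⟨_, _, hc, e, _⟩ | ⟨_, e, _⟩ | ⟨_, _, _, _, e, _⟩ <;> rw [e] at ht2 ht3
    · exact I.completed t ht1 ht2 ht3
    -- The new timestamp is excluded by `ht3`; the older ones are all completed because the writer
    -- was idle.
    · refine I.completed t ht1 ?_ (by simp [hid])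
      simp at ht2 ht3
      omega
    -- The returning write has `2f + 1` acknowledgements; one comes from a correct server, which
    -- acknowledges only what it has delivered.
    · by_cases htw : t = s.writer.ts
      · obtain ⟨i, hi, hi'⟩ := exists_correct_of_lt_ncard hF
          (A := {x | s.writer.acks x = some s.writer.ts}) (by have := hc.2.2; omega)
        exact ⟨i, hi', htw ▸ I.ack_received i hi' _ hi⟩
      · exact I.completed t ht1 ht2 (by simp [htw])
    · exact I.completed t ht1 ht2 (by simp [hid])
    · exact I.completed t ht1 ht2 (by simp [hc.2.1])
    · exact I.completed t ht1 ht2 ht3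
    · simp only [writerReceive_spec] at ht2 ht3
      exact I.completed t ht1 ht2 ht3

theorem Execution.writeInvariant (hn : n = 3 * f + 1) (hF : F.servers.ncard ≤ f)
    (E : Execution f F v₀) (t : ℕ) : WriteInvariant F v₀ (E.state t) := by
  induction t with
  | zero => rw [E.start]; exact writeInvariant_initialState
  | succ t ih => exact ih.step hn hF (E.step t)

/-- A server whose register timestamp is at least `x` witnesses that `x` is the initial timestamp or
that of a write delivered by a correct server. -/
theorem WriteInvariant.delivered_of_le_regTs (I : WriteInvariant F v₀ s) {i : Fin n}
    (hi : i ∉ F.servers) {x : ℤ} (h0 : 0 ≤ x) (hx : x ≤ (s.servers i).regTs) :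
    x = 0 ∨ ∃ j, j ∉ F.servers ∧ ∃ m ∈ s.delivered j, m.ts = x := by
  by_cases hx0 : x = 0
  · exact .inl hx0
  right
  rcases I.regTs i with h | ⟨m, hm, h⟩
  · omega
  · by_cases hxe : x = m.ts
    · exact ⟨i, hi, m, hm, hxe.symm⟩
    -- Here `x < m.ts ≤ s.writer.ts`, so `x` cannot be the timestamp of the write in progress.
    · have := (I.broadcast m (I.delivered i m hm)).2.1
      exact I.completed x (by omega) (by omega) (by omega)

/-- A timestamp identifies its write, and `0` is never broadcast, so it is reserved for the initial
value. -/
theorem WriteInvariant.value_unique (I : WriteInvariant F v₀ s) {i j : Fin n} {b b' : Block n V}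
    {x : ℤ} (hb : (b, x) ∈ (s.servers i).val) (hb' : (b', x) ∈ (s.servers j).val) :
    b = ⟨i, b'.value⟩ := by
  rcases (I.val i b x).1 hb with ⟨rfl, rfl⟩ | ⟨m, hm, rfl, rfl⟩ <;>
    rcases (I.val j b' _).1 hb' with ⟨h0, rfl⟩ | ⟨m', hm', h0, rfl⟩
  · rfl
  · have := (I.broadcast m' (I.delivered j m' hm')).1
    omega
  · have := (I.broadcast m (I.delivered i m hm)).1
    omega
  · obtain ⟨-, -, v, hv⟩ := I.broadcast m (I.delivered i m hm)
    rw [I.broadcast_unique m' (I.delivered j m' hm') m (I.delivered i m hm) h0, hv]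
    rfl

/-! ### The minimal timestamp of a read -/

theorem finset_min_le_iff {C : Finset ℤ} {t : ℤ} :
    C.min ≤ (t : WithTop ℤ) ↔ ∃ x ∈ C, x ≤ t := by
  constructor
  · intro h
    rcases C.eq_empty_or_nonempty with rfl | hC
    · simp at h
    · refine ⟨C.min' hC, C.min'_mem hC, ?_⟩
      rw [← Finset.coe_min' hC] at h
      exact_mod_cast h
  · rintro ⟨x, hx, hxt⟩
    exact (Finset.min_le hx).trans (by exact_mod_cast hxt)

/-- Enlarging the sets only lowers their minima. -/
theorem NotOld.mono {C C' : Fin n → Finset ℤ} (h : ∀ i, C i ⊆ C' i) {t : ℤ}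
    (hC : NotOld f C t) : NotOld f C' t :=
  le_trans hC (Set.ncard_le_ncard (fun i hi => (Finset.min_mono (h i)).trans hi) (Set.toFinite _))

theorem leastNotOld_eq_some {C : Fin n → Finset ℤ} {m : ℤ} (h : leastNotOld f C = some m) :
    (∃ i, m ∈ C i) ∧ NotOld f C m ∧ ∀ i, ∀ x ∈ C i, NotOld f C x → m ≤ x := by
  classical
  unfold leastNotOld at h
  split at h
  case isTrue hne =>
    simp only [Option.some.injEq] at h
    subst h
    have := Finset.min'_mem _ hne
    simp only [Finset.mem_filter, Finset.mem_biUnion, Finset.mem_univ, true_and] at this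
    refine ⟨this.1, this.2, fun i x hx hxo => Finset.min'_le _ _ ?_⟩
    simp only [Finset.mem_filter, Finset.mem_biUnion, Finset.mem_univ, true_and]
    exact ⟨⟨i, hx⟩, hxo⟩
  case isFalse => cases h

theorem exists_leastNotOld_le {C : Fin n → Finset ℤ} {i : Fin n} {x : ℤ} (hx : x ∈ C i)
    (hxo : NotOld f C x) : ∃ m, leastNotOld f C = some m ∧ m ≤ x := by
  classical
  have hne : ((Finset.univ.biUnion C).filter (NotOld f C)).Nonempty := by
    refine ⟨x, ?_⟩
    simp only [Finset.mem_filter, Finset.mem_biUnion, Finset.mem_univ, true_and]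
    exact ⟨⟨i, hx⟩, hxo⟩
  have h : leastNotOld f C = some (((Finset.univ.biUnion C).filter (NotOld f C)).min' hne) := by
    simp only [leastNotOld, dif_pos hne]
  exact ⟨_, h, (leastNotOld_eq_some h).2.2 i x hx hxo⟩

/-! ### Reception of a message by a reader -/

theorem readerReceive_phase (st : ReaderState n V) (src : Proc n R) (m : Msg n R V) :
    (readerReceive f st src m).1.phase = st.phase := by
  unfold readerReceive
  split <;> (try split) <;> (try dsimp only)
  all_goals try split
  all_goals rfl

theorem readerReceive_nseq (st : ReaderState n V) (src : Proc n R) (m : Msg n R V) :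
    (readerReceive f st src m).1.nseq = st.nseq := by
  unfold readerReceive
  split <;> (try split) <;> (try dsimp only)
  all_goals try split
  all_goals rfl

theorem readerReceive_subset (st : ReaderState n V) (src : Proc n R) (m : Msg n R V)
    (i : Fin n) : st.collectedTs i ⊆ (readerReceive f st src m).1.collectedTs i := by
  unfold readerReceive
  split <;> (try split) <;> (try dsimp only) <;> (try split) <;>
    (try simp only [Function.update_apply]) <;> (try split) <;> (try subst_vars) <;> simp

theorem mem_readerReceive_collectedTs {st : ReaderState n V} {src : Proc n R} {m : Msg n R V}
    {i : Fin n} {t : ℤ} (h : t ∈ (readerReceive f st src m).1.collectedTs i) :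
    t ∈ st.collectedTs i ∨
      src = .server i ∧ (m = .tsResp t st.nseq ∨ m = .valResp t st.nseq) := by
  revert h
  unfold readerReceive
  split <;> (try split) <;> (try dsimp only) <;> (try split) <;>
    (try simp only [Function.update_apply]) <;> (try split) <;> (try subst_vars)
  all_goals grind

theorem readerReceive_collectedBlocks (st : ReaderState n V) (src : Proc n R) (m : Msg n R V)
    (i : Fin n) :
    (readerReceive f st src m).1.collectedBlocks i = st.collectedBlocks i ∨
      ∃ b t, src = .server i ∧ m = .blockResp b t st.nseq ∧
        (readerReceive f st src m).1.collectedBlocks i = some (b, t) := by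
  unfold readerReceive
  split <;> (try split) <;> (try dsimp only) <;> (try split) <;>
    (try simp only [Function.update_apply]) <;> (try split) <;> (try subst_vars) <;> simp

/-- Recomputing `minTs` and requesting its new value happen in the same step, so during a read
`minTs` never takes a value for which no `VAL_REQ` was sent. -/
theorem readerReceive_minTs (st : ReaderState n V) (src : Proc n R) (m : Msg n R V) :
    ((readerReceive f st src m).1.minTs = st.minTs ∧ (readerReceive f st src m).2 = []) ∨
    ((readerReceive f st src m).1.minTs =
        leastNotOld f (readerReceive f st src m).1.collectedTs ∧
      (∀ x, (readerReceive f st src m).1.minTs = some x →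
        (readerReceive f st src m).2 = toServers (.valReq x st.nseq)) ∧
      ((readerReceive f st src m).1.minTs = none → (readerReceive f st src m).2 = [])) := by
  unfold readerReceive
  split <;> (try split) <;> (try dsimp only) <;> (try split) <;> simp_all

theorem readerReceive_tsResp_minTs (st : ReaderState n V) (i : Fin n) (x : ℤ)
    (h : n - f ≤ {j | (readerReceive (R := R) f st (.server i)
      (.tsResp x st.nseq)).1.collectedTs j ≠ ∅}.ncard) :
    (readerReceive (R := R) f st (.server i) (.tsResp x st.nseq)).1.minTs =
      leastNotOld f
        (readerReceive (R := R) f st (.server i) (.tsResp x st.nseq)).1.collectedTs := by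
  revert h
  simp only [readerReceive, if_true]
  split
  case isTrue => exact fun _ => rfl
  case isFalse h' => exact fun h => absurd h h'

theorem mem_readerReceive_out {st : ReaderState n V} {src : Proc n R} {m : Msg n R V}
    {d : Proc n R} {msg : Msg n R V} (h : (d, msg) ∈ (readerReceive f st src m).2) :
    ∃ x, msg = .valReq x st.nseq ∧ (readerReceive f st src m).1.minTs = some x ∧
      leastNotOld f (readerReceive f st src m).1.collectedTs = some x := by
  rcases readerReceive_minTs (f := f) st src m with ⟨-, h'⟩ | ⟨h1, h2, h3⟩
  · rw [h'] at h; cases h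
  · rcases hx : (readerReceive f st src m).1.minTs with _ | x
    · rw [h3 hx] at h; cases h
    · rw [h2 x hx, mem_toServers] at h
      exact ⟨x, h.1, rfl, by rw [← h1, hx]⟩

/-! ### Invariants of the reads: timestamps -/

/-- What a correct server reports is bounded by its own `regTs`. Nonnegativity has to be carried
around the whole loop `minTs`, `VAL_REQ`, pending request, `VAL_RESP`, collected set, because a
correct server echoes the timestamp it was asked about. -/
structure TimestampInvariant (f : ℕ) (F : Faults n R) (r : R) (s : State n R V) : Prop where
  tsResp : ∀ i, i ∉ F.servers → ∀ t k, ⟨.server i, .reader r, .tsResp t k⟩ ∈ s.net →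
    0 ≤ t ∧ t ≤ (s.servers i).regTs
  valResp : ∀ i, i ∉ F.servers → ∀ t k, ⟨.server i, .reader r, .valResp t k⟩ ∈ s.net →
    0 ≤ t ∧ t ≤ (s.servers i).regTs
  valReq : ∀ d t k, ⟨.reader r, d, .valReq t k⟩ ∈ s.net → 0 ≤ t
  pendingVal : ∀ i, i ∉ F.servers → ∀ t k, (r, t, k) ∈ (s.servers i).pendingVal → 0 ≤ t
  collectedTs : ∀ i, i ∉ F.servers → ∀ t ∈ (s.readers r).collectedTs i,
    0 ≤ t ∧ t ≤ (s.servers i).regTs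
  minTs : ∀ m, (s.readers r).minTs = some m →
    (∃ i, m ∈ (s.readers r).collectedTs i) ∧ NotOld f (s.readers r).collectedTs m

/-- Among the `2f + 1` servers with a minimum at most `m`, one is correct. -/
theorem NotOld.nonneg (hF : F.servers.ncard ≤ f) {C : Fin n → Finset ℤ}
    (hC : ∀ i, i ∉ F.servers → ∀ t ∈ C i, 0 ≤ t) {m : ℤ} (h : NotOld f C m) : 0 ≤ m := by
  obtain ⟨i, hi, hi'⟩ := exists_correct_of_lt_ncard hF (le_trans (by omega) h)
  obtain ⟨x, hx, hxm⟩ := finset_min_le_iff.1 hi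
  exact (hC i hi' x hx).trans hxm

theorem timestampInvariant_initialState (r : R) :
    TimestampInvariant f F r (initialState n R v₀) := by
  constructor <;> simp [initialState]

theorem mem_serverReceive_out {st : ServerState n R V} {src d : Proc n R} {m msg : Msg n R V}
    (h : (d, msg) ∈ (serverReceive st src m).2) :
    (∃ r k, src = .reader r ∧ m = .tsReq k ∧ d = .reader r ∧ msg = .tsResp st.regTs k) ∨
    (src = .writer ∧ m = .auditReq ∧ d = .writer ∧ msg = .auditResp st.log) := by
  revert h
  unfold serverReceive
  split <;> (try split) <;> simp_all

theorem mem_serverReceive_pendingVal {st : ServerState n R V} {src : Proc n R} {m : Msg n R V}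
    {q : R × ℤ × ℤ} :
    q ∈ (serverReceive st src m).1.pendingVal ↔
      q ∈ st.pendingVal ∨ (src = .reader q.1 ∧ m = .valReq q.2.1 q.2.2) := by
  unfold serverReceive
  split <;> (try split) <;> simp_all
  grind

theorem mem_serverReceive_pendingBlock {st : ServerState n R V} {src : Proc n R} {m : Msg n R V}
    {rc : SignedRecord R} :
    rc ∈ (serverReceive st src m).1.pendingBlock ↔
      rc ∈ st.pendingBlock ∨
        (rc.signer = rc.reader ∧ src = .reader rc.reader ∧ m = .blockReq rc) := by
  unfold serverReceive
  split <;> (try split) <;> simp_all <;> grind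

theorem WriteInvariant.regTs_nonneg (I : WriteInvariant F v₀ s) (i : Fin n) :
    0 ≤ (s.servers i).regTs := by
  rcases I.regTs i with h | ⟨m, hm, h⟩
  · omega
  · have := (I.broadcast m (I.delivered i m hm)).1
    omega

theorem TimestampInvariant.step (hF : F.servers.ncard ≤ f) {r : R} (hr : r ∉ F.readers)
    (W : WriteInvariant F v₀ s) (I : TimestampInvariant f F r s) (h : Step f F s a s') :
    TimestampInvariant f F r s' := by
  have hmono : ∀ {i t}, 0 ≤ t ∧ t ≤ (s.servers i).regTs → 0 ≤ t ∧ t ≤ (s'.servers i).regTs :=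
    fun {i t} ht => ⟨ht.1, ht.2.trans (h.regTs_mono i)⟩
  have hC : ∀ i, i ∉ F.servers → ∀ t ∈ (s'.readers r).collectedTs i,
      0 ≤ t ∧ t ≤ (s'.servers i).regTs := by
    intro i hi t ht
    apply hmono
    rcases h.reader_cases r with e | ⟨-, e⟩ | ⟨-, -, e⟩ | ⟨-, -, e⟩ | ⟨src, m, -, hp, e⟩ <;>
      rw [e] at ht
    · exact I.collectedTs i hi t ht
    · simp at ht
    · exact I.collectedTs i hi t ht
    · exact I.collectedTs i hi t ht
    · rcases mem_readerReceive_collectedTs ht with ht | ⟨rfl, rfl | rfl⟩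
      · exact I.collectedTs i hi t ht
      · exact I.tsResp i hi t _ hp
      · exact I.valResp i hi t _ hp
  have hmin : ∀ m, (s'.readers r).minTs = some m →
      (∃ i, m ∈ (s'.readers r).collectedTs i) ∧ NotOld f (s'.readers r).collectedTs m := by
    intro x hx
    rcases h.reader_cases r with e | ⟨-, e⟩ | ⟨-, -, e⟩ | ⟨-, -, e⟩ | ⟨src, m, -, hp, e⟩ <;>
      rw [e] at hx ⊢
    · exact I.minTs x hx
    · cases hx
    · exact I.minTs x hx
    · exact I.minTs x hx
    · have hsub := readerReceive_subset (f := f) (s.readers r) src m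
      rcases readerReceive_minTs (f := f) (s.readers r) src m with ⟨h1, -⟩ | ⟨h1, -⟩ <;>
        rw [h1] at hx
      · obtain ⟨⟨i, hi⟩, h2⟩ := I.minTs x hx
        exact ⟨⟨i, hsub i hi⟩, h2.mono hsub⟩
      · have := leastNotOld_eq_some hx
        exact ⟨this.1, this.2.1⟩
  constructor
  case collectedTs => exact hC
  case minTs => exact hmin
  case tsResp =>
    intro i hi t k hp
    apply hmono
    rcases h.net_from_server hi hp with hp | ⟨src, m, -, hm⟩ | ⟨m, -, -, hm⟩ |
      ⟨r, ts, k, -, -, -, -, hm⟩ | ⟨_, _, _, _, _, _, hm⟩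
    · exact I.tsResp i hi t k hp
    · rcases mem_serverReceive_out hm with ⟨_, _, -, -, -, e⟩ | ⟨-, -, -, e⟩ <;> cases e
      exact ⟨W.regTs_nonneg i, le_rfl⟩
    all_goals cases hm
  case valResp =>
    intro i hi t k hp
    apply hmono
    rcases h.net_from_server hi hp with hp | ⟨src, m, -, hm⟩ | ⟨m, -, -, hm⟩ |
      ⟨r, ts, k, -, hq, hts, hd, hm⟩ | ⟨_, _, _, _, _, _, hm⟩
    · exact I.valResp i hi t k hp
    · rcases mem_serverReceive_out hm with ⟨_, _, -, -, -, e⟩ | ⟨-, -, -, e⟩ <;> cases e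
    · cases hm
    · cases hm; cases hd
      exact ⟨I.pendingVal i hi _ _ hq, hts⟩
    · cases hm
  case valReq =>
    intro d t k hp
    rcases h.net_from_reader hr hp with hp | ⟨-, e⟩ | ⟨-, _, -, e⟩ | ⟨src, m, e, hm⟩
    · exact I.valReq d t k hp
    · cases e
    · cases e
    · obtain ⟨x, e1, e2, e3⟩ := mem_readerReceive_out hm
      cases e1
      subst e
      have : (s'.readers r).minTs = some t := by
        cases h
        · simpa using e2
        · cases ‹F.Byzantine _›; contradiction
      -- The requested timestamp is the freshly computed `minTs`, so `NotOld` puts a nonnegative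
      -- entry of a correct server below it.
      exact (hmin t this).2.nonneg hF fun i hi t ht => (hC i hi t ht).1
  case pendingVal =>
    intro i hi t k hq
    rcases h.server_cases i with ⟨e, _⟩ | ⟨_, _, _, hp, e, _⟩ | ⟨_, _, _, e, _⟩ |
      ⟨q, rest, _, hq', e, _⟩ | ⟨_, _, _, _, e, _⟩ <;> rw [e] at hq
    · exact I.pendingVal i hi t k hq
    · rcases mem_serverReceive_pendingVal.1 hq with hq | ⟨rfl, rfl⟩
      · exact I.pendingVal i hi t k hq
      · exact I.valReq _ _ _ hp
    · exact I.pendingVal i hi t k hq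
    · exact I.pendingVal i hi t k (by rw [hq']; exact Multiset.mem_cons_of_mem hq)
    · exact I.pendingVal i hi t k hq

theorem Execution.timestampInvariant (hn : n = 3 * f + 1) (hF : F.servers.ncard ≤ f)
    (E : Execution f F v₀) {r : R} (hr : r ∉ F.readers) (t : ℕ) :
    TimestampInvariant f F r (E.state t) := by
  induction t with
  | zero => rw [E.start]; exact timestampInvariant_initialState r
  | succ t ih => exact ih.step hF hr (E.writeInvariant hn hF t) (E.step t)

/-! ### Invariants of the reads: blocks -/

/-- A request by `r` to server `i` for its block with timestamp `t`, made in the read number `k`,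
or the response to it, is in transit or pending. -/
inductive BlockTrace (s : State n R V) (r : R) (i : Fin n) (t k : ℤ) : Prop where
  | request (h : ⟨.reader r, .server i, .blockReq ⟨r, r, t, k⟩⟩ ∈ s.net)
  | pending (x : R) (h : ⟨x, r, t, k⟩ ∈ (s.servers i).pendingBlock)
  | response (b : Block n V) (h : ⟨.server i, .reader r, .blockResp b t k⟩ ∈ s.net)

/-- Read backwards, a response stems from a pending record, and the record from a request of `r`
itself, since correct servers reject records that do not name their sender as signer and reader. The
only source of new traces is thus `readBlocks`. -/
theorem BlockTrace.of_step {r : R} (hr : r ∉ F.readers) {i : Fin n} (hi : i ∉ F.servers)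
    {t k : ℤ} (h : Step f F s a s') (T : BlockTrace s' r i t k) :
    BlockTrace s r i t k ∨
      (a = .readBlocks r ∧ (s.readers r).CanGetBlocks f t ∧ k = (s.readers r).nseq) := by
  cases T with
  | request hp =>
    rcases h.net_from_reader hr hp with hp | ⟨-, e⟩ | ⟨e, _, hc, e'⟩ | ⟨src, m, e, hm⟩
    · exact .inl (.request hp)
    · cases e
    · cases e'
      exact .inr ⟨e, hc, rfl⟩
    · obtain ⟨x, e1, -⟩ := mem_readerReceive_out hm
      cases e1
  | pending x hq =>
    left
    rcases h.server_cases i with ⟨e, _⟩ | ⟨_, _, _, hp, e, _⟩ | ⟨_, _, _, e, _⟩ |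
      ⟨q, rest, _, hq', e, _⟩ | ⟨_, _, _, hq', e, _⟩ <;> rw [e] at hq
    · exact .pending x hq
    · rcases mem_serverReceive_pendingBlock.1 hq with hq | ⟨hs, rfl, rfl⟩
      · exact .pending x hq
      · cases hs
        exact .request hp
    · exact .pending x hq
    · exact .pending x hq
    · exact .pending x (by rw [hq']; exact Multiset.mem_cons_of_mem hq)
  | response b hp =>
    left
    rcases h.net_from_server hi hp with hp | ⟨src, m, -, hm⟩ | ⟨m, -, -, hm⟩ |
      ⟨r, ts, k, -, -, -, -, hm⟩ | ⟨rc, _, _, hq, _, hd, hm⟩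
    · exact .response b hp
    · rcases mem_serverReceive_out hm with ⟨_, _, -, -, -, e⟩ | ⟨-, -, -, e⟩ <;> cases e
    · cases hm
    · cases hm
    · cases hm; cases hd
      exact .pending _ hq

/-- The field `trace` says that the current read number is unused in block traffic with correct
servers until the first wait ends; therefore no leftover of an earlier read can pass for an answer
to the current one. -/
structure BlockInvariant (F : Faults n R) (r : R) (s : State n R V) : Prop where
  trace : ∀ i, i ∉ F.servers → ∀ t k, BlockTrace s r i t k → k ≤ (s.readers r).nseq ∧
    (k = (s.readers r).nseq → (s.readers r).phase ≠ .collectTs)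
  response : ∀ i, i ∉ F.servers → ∀ b t k,
    ⟨.server i, .reader r, .blockResp b t k⟩ ∈ s.net → (b, t) ∈ (s.servers i).val
  collected : ∀ i, i ∉ F.servers → ∀ b t, (s.readers r).collectedBlocks i = some (b, t) →
    (b, t) ∈ (s.servers i).val
  not_collected : (s.readers r).phase = .collectTs → ∀ i, i ∉ F.servers →
    (s.readers r).collectedBlocks i = none

theorem blockInvariant_initialState (r : R) : BlockInvariant F r (initialState n R v₀) := by
  constructor
  · rintro i - t k (h | ⟨_, h⟩ | ⟨_, h⟩) <;> simp [initialState] at h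
  all_goals simp [initialState]

theorem Step.val_mono (h : Step f F s a s') {i : Fin n} {x : Block n V × ℤ}
    (hx : x ∈ (s.servers i).val) : x ∈ (s'.servers i).val := by
  rcases h.server_cases i with ⟨h, _⟩ | ⟨_, _, _, _, h, _⟩ | ⟨_, _, _, h, _⟩ | ⟨_, _, _, _, h, _⟩ |
    ⟨_, _, _, _, h, _⟩ <;> rw [h]
  · exact hx
  · simpa using hx
  · simp only [serverDeliver]
    split
    · exact List.mem_cons_of_mem _ hx
    · exact hx
  · exact hx
  · exact hx

theorem BlockInvariant.step {r : R} (hr : r ∉ F.readers) (I : BlockInvariant F r s)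
    (h : Step f F s a s') : BlockInvariant F r s' := by
  constructor
  case trace =>
    intro i hi t k T
    rcases T.of_step hr hi h with T | ⟨rfl, hc, rfl⟩
    · have := I.trace i hi t k T
      rcases h.reader_cases r with e | ⟨-, e⟩ | ⟨-, -, e⟩ | ⟨-, -, e⟩ | ⟨src, m, -, hp, e⟩ <;>
        rw [e]
      · exact this
      · exact ⟨by dsimp only; omega, fun e => by dsimp only at e; omega⟩
      · exact ⟨this.1, by simp⟩
      · exact ⟨this.1, by simp⟩
      · rwa [readerReceive_nseq, readerReceive_phase]
    · cases h
      simp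
  case response =>
    intro i hi b t k hp
    apply h.val_mono
    rcases h.net_from_server hi hp with hp | ⟨src, m, -, hm⟩ | ⟨m, -, -, hm⟩ |
      ⟨r, ts, k, -, -, -, -, hm⟩ | ⟨rc, _, _, hq, hb, hd, hm⟩
    · exact I.response i hi b t k hp
    · rcases mem_serverReceive_out hm with ⟨_, _, -, -, -, e⟩ | ⟨-, -, -, e⟩ <;> cases e
    · cases hm
    · cases hm
    · cases hm
      exact hb
  case collected =>
    intro i hi b t hc
    apply h.val_mono
    rcases h.reader_cases r with e | ⟨-, e⟩ | ⟨-, -, e⟩ | ⟨-, -, e⟩ | ⟨src, m, -, hp, e⟩ <;>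
      rw [e] at hc
    · exact I.collected i hi b t hc
    · cases hc
    · exact I.collected i hi b t hc
    · exact I.collected i hi b t hc
    · rcases readerReceive_collectedBlocks (f := f) (s.readers r) src m i with
        e' | ⟨b', t', rfl, rfl, e'⟩ <;> rw [e'] at hc
      · exact I.collected i hi b t hc
      · cases hc
        exact I.response i hi _ _ _ hp
  case not_collected =>
    intro hph i hi
    rcases h.reader_cases r with e | ⟨-, e⟩ | ⟨-, -, e⟩ | ⟨-, -, e⟩ | ⟨src, m, -, hp, e⟩ <;>
      rw [e] at hph ⊢
    · exact I.not_collected hph i hi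
    · cases hph
    · cases hph
    · rw [readerReceive_phase] at hph
      rcases readerReceive_collectedBlocks (f := f) (s.readers r) src m i with
        e' | ⟨b', t', rfl, rfl, e'⟩
      · rw [e']; exact I.not_collected hph i hi
      -- A block accepted now would be a trace of the current number before any request was made.
      · exact absurd hph ((I.trace i hi _ _ (.response _ hp)).2 rfl)

theorem Execution.blockInvariant (E : Execution f F v₀) {r : R} (hr : r ∉ F.readers) (t : ℕ) :
    BlockInvariant F r (E.state t) := by
  induction t with
  | zero => rw [E.start]; exact blockInvariant_initialState r
  | succ t ih => exact ih.step hr (E.step t)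

/-! ### Effects of receptions and deliveries -/

theorem Step.receive_server {i : Fin n} (hi : i ∉ F.servers) {src : Proc n R} {m : Msg n R V}
    (h : Step f F s (.receive ⟨src, .server i, m⟩) s') :
    s'.servers i = (serverReceive (s.servers i) src m).1 ∧
    ∀ d msg, (d, msg) ∈ (serverReceive (s.servers i) src m).2 →
      ⟨.server i, d, msg⟩ ∈ s'.net := by
  cases h with
  | receiveServer _ _ _ rest _ hnet => simp +contextual [mem_packets]
  | receiveByzantine _ rest hp hnet => cases hp; contradiction

theorem Step.receive_reader {r : R} (hr : r ∉ F.readers) {src : Proc n R} {m : Msg n R V}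
    (h : Step f F s (.receive ⟨src, .reader r, m⟩) s') :
    s'.readers r = (readerReceive f (s.readers r) src m).1 ∧
    ∀ d msg, (d, msg) ∈ (readerReceive f (s.readers r) src m).2 →
      ⟨.reader r, d, msg⟩ ∈ s'.net := by
  cases h with
  | receiveReader _ _ _ rest _ hnet => simp +contextual [mem_packets]
  | receiveByzantine _ rest hp hnet => cases hp; contradiction

theorem Step.receive_writer {src : Proc n R} {m : Msg n R V}
    (h : Step f F s (.receive ⟨src, .writer, m⟩) s') :
    s'.writer = writerReceive s.writer src m := by
  cases h with
  | receiveWriter _ _ rest _ hnet => rfl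
  | receiveByzantine _ rest hp hnet => cases hp

/-! ### Temporal reasoning -/

theorem eventually_of_stable {P : ℕ → Prop} {t : ℕ} (h : P t)
    (hs : ∀ u, t ≤ u → P u → P (u + 1)) : ∀ᶠ u in atTop, P u :=
  eventually_atTop.2 ⟨t, fun _ hu => Nat.le_induction h hs _ hu⟩

namespace Execution

variable {E : Execution f F v₀}

/-- A task that stays pending until it is performed, and that is eventually enabled while it is
pending, is performed. -/
theorem Admissible.performed (hE : E.Admissible) {a : Task n R} (ha : E.Correct a.owner)
    {P : ℕ → Prop} {t : ℕ} (h : P t)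
    (hs : ∀ u, t ≤ u → P u → (E.action u).task = some a ∨ P (u + 1))
    (hen : ∀ᶠ u in atTop, P u → a.Enabled f (E.state u)) :
    ∃ u, t ≤ u ∧ (E.action u).task = some a := by
  by_contra! hno
  have hP : ∀ u, t ≤ u → P u := fun u hu =>
    Nat.le_induction h (fun u hu hu' => (hs u hu hu').resolve_left (hno u hu)) u hu
  obtain ⟨T, hT⟩ := eventually_atTop.1 hen
  obtain ⟨u, hu, hu'⟩ := hE.progress a ha (max t T) fun u hu =>
    hT u (le_of_max_le_right hu) (hP u (le_of_max_le_left hu))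
  exact hno u (le_of_max_le_left hu) hu'

theorem Admissible.performed_of_eventually (hE : E.Admissible) {a : Task n R}
    (ha : E.Correct a.owner) (hen : ∀ᶠ u in atTop, a.Enabled f (E.state u)) (t : ℕ) :
    ∃ u, t ≤ u ∧ (E.action u).task = some a :=
  hE.performed ha (P := fun _ => True) trivial (fun _ _ _ => .inr trivial)
    (hen.mono fun _ h _ => h)

theorem eventually_correct {P : Fin n → ℕ → Prop}
    (h : ∀ i, i ∉ F.servers → ∀ᶠ u in atTop, P i u) :
    ∀ᶠ u in atTop, ∀ i, i ∉ F.servers → P i u := by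
  rw [eventually_all]
  intro i
  by_cases hi : i ∈ F.servers
  · exact .of_forall fun _ h => absurd hi h
  · exact (h i hi).mono fun _ h _ => h

/-! ### Deliveries -/

/-- Recovers the delivery event, which is what `termination_two` takes as input. -/
theorem exists_deliver_of_mem (E : Execution f F v₀) {i : Fin n} {m : WriteMsg n V} {t : ℕ}
    (h : m ∈ (E.state t).delivered i) : ∃ u, u < t ∧ E.action u = .deliver i m := by
  induction t with
  | zero => rw [E.start] at h; cases h
  | succ t ih =>
    by_cases hm : m ∈ (E.state t).delivered i
    · obtain ⟨u, hu, hu'⟩ := ih hm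
      exact ⟨u, by omega, hu'⟩
    · refine ⟨t, by omega, ?_⟩
      rcases (E.step t).server_cases i with ⟨_, e⟩ | ⟨_, _, _, _, _, e⟩ | ⟨_, ha, _, _, e⟩ |
        ⟨_, _, _, _, _, e⟩ | ⟨_, _, _, _, _, e⟩ <;> rw [e] at h
      · exact absurd h hm
      · exact absurd h hm
      · rcases h with rfl | h
        exacts [ha, absurd h hm]
      · exact absurd h hm
      · exact absurd h hm

theorem mem_delivered_of_deliver {i : Fin n} {m : WriteMsg n V} {t : ℕ}
    (h : E.action t = .deliver i m) : m ∈ (E.state (t + 1)).delivered i := by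
  have hs := E.step t
  rw [h] at hs
  generalize E.state (t + 1) = s' at hs ⊢
  cases hs
  simp

theorem eventually_mem_delivered {i : Fin n} {m : WriteMsg n V} {t : ℕ}
    (h : m ∈ (E.state t).delivered i) : ∀ᶠ u in atTop, m ∈ (E.state u).delivered i :=
  eventually_of_stable h fun u _ hu => (E.step u).delivered_mono i hu

/-- If the register timestamp of some correct server is at least `x`, then every correct server
eventually has `reg_ts ≥ x` and its block for the timestamp `x`. -/
theorem Admissible.eventually_block (hE : E.Admissible) (hn : n = 3 * f + 1)
    (hF : F.servers.ncard ≤ f) {i j : Fin n} (hi : i ∉ F.servers) (hj : j ∉ F.servers) {x : ℤ}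
    {t : ℕ} (h0 : 0 ≤ x) (hx : x ≤ ((E.state t).servers i).regTs) :
    ∀ᶠ u in atTop, x ≤ ((E.state u).servers j).regTs ∧
      ∃ b, (b, x) ∈ ((E.state u).servers j).val := by
  -- Deliveries are unordered, so `i` itself may have skipped the write `x`; the invariant supplies
  -- another correct server `l` that delivered it.
  rcases (E.writeInvariant hn hF t).delivered_of_le_regTs hi h0 hx with
    rfl | ⟨l, hl, m, hm, rfl⟩
  · refine .of_forall fun u => ?_
    have W := E.writeInvariant hn hF u
    exact ⟨W.regTs_nonneg j, _, (W.val j _ _).2 (.inl ⟨rfl, rfl⟩)⟩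
  · obtain ⟨u, -, hu⟩ := E.exists_deliver_of_mem hm
    obtain ⟨w, hw⟩ := hE.termination_two u l m hl hu j hj
    filter_upwards [eventually_mem_delivered (mem_delivered_of_deliver hw)] with v hv
    have W := E.writeInvariant hn hF v
    exact ⟨W.le_regTs j m hv, _, (W.val j _ _).2 (.inr ⟨m, hv, rfl, rfl⟩)⟩

/-! ### Matching responses -/

/-- Choose the first return after `t`. Until then the phase is not idle, which rules out a new
invocation by `r`. -/
theorem hasMatchingResponse_of_reader {r : R} {t : ℕ} (ht : E.action t = .readInvoke r)
    (h : ∃ u v, t < u ∧ E.action u = .readReturn r v) :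
    E.HasMatchingResponse (.reader r) .read t := by
  classical
  have h' : ∃ u, t < u ∧ ∃ v, E.action u = .readReturn r v := by
    obtain ⟨u, v, h1, h2⟩ := h; exact ⟨u, h1, v, h2⟩
  obtain ⟨h1, v, h2⟩ := Nat.find_spec h'
  have hmin := fun u => Nat.find_min h' (m := u)
  refine ⟨Nat.find h', h1, by rw [h2]; rfl, ?_⟩
  generalize Nat.find h' = T at *
  have hphase : ∀ u, t + 1 ≤ u → u ≤ T → ((E.state u).readers r).phase ≠ .idle := by
    intro u hu
    induction u, hu using Nat.le_induction with
    | base =>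
      intro _
      have hs := E.step t
      rw [ht] at hs
      generalize E.state (t + 1) = s' at hs ⊢
      cases hs
      simp
    | succ u hu ih =>
      intro huT
      have ih := ih (by omega)
      have hmin := hmin u (by omega)
      rcases (E.step u).reader_cases r with e | ⟨-, e⟩ | ⟨-, -, e⟩ | ⟨v, ha, -⟩ |
        ⟨src, m, -, hp, e⟩
      · rwa [e]
      · simp [e]
      · simp [e]
      · exact absurd ⟨by omega, v, ha⟩ hmin
      · rwa [e, readerReceive_phase]
  intro u hu huT k'
  have hph := hphase u hu huT.le
  have hmin := hmin u huT
  have hs := E.step u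
  generalize E.state (u + 1) = s' at hs
  constructor <;> intro hk <;> generalize ha : E.action u = a at hs hk <;> cases hs <;>
    simp_all [Action.invocation, Action.response]

/-- As for reads, but the exact phase is tracked, because the response of an audit must be ruled out
too. -/
theorem hasMatchingResponse_of_write {t : ℕ} {v : V} (ht : E.action t = .writeInvoke v)
    (h : ∃ u, t < u ∧ E.action u = .writeReturn) :
    E.HasMatchingResponse .writer .write t := by
  classical
  obtain ⟨h1, h2⟩ := Nat.find_spec h
  have hmin := fun u => Nat.find_min h (m := u)
  refine ⟨Nat.find h, h1, by rw [h2]; rfl, ?_⟩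
  generalize Nat.find h = T at *
  have hphase : ∀ u, t + 1 ≤ u → u ≤ T → (E.state u).writer.phase = .writing := by
    intro u hu
    induction u, hu using Nat.le_induction with
    | base =>
      intro _
      have hs := E.step t
      rw [ht] at hs
      generalize E.state (t + 1) = s' at hs ⊢
      cases hs
      simp
    | succ u hu ih =>
      intro huT
      have ih := ih (by omega)
      have hmin := hmin u (by omega)
      rcases (E.step u).writer_cases with ⟨e, _⟩ | ⟨_, _, hid, _⟩ | ⟨ha, _⟩ | ⟨_, hid, _⟩ |
        ⟨_, _, hc, _⟩ | ⟨_, e, _⟩ | ⟨_, _, _, _, e, _⟩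
      · rwa [e]
      · simp [ih] at hid
      · exact absurd ⟨by omega, ha⟩ hmin
      · simp [ih] at hid
      · have := hc.2.1; simp [ih] at this
      · rwa [e]
      · rwa [e, (writerReceive_spec _ _ _).2.1]
  intro u hu huT k'
  have hph := hphase u hu huT.le
  have hmin := hmin u huT
  have hs := E.step u
  generalize E.state (u + 1) = s' at hs
  constructor <;> intro hk <;> generalize ha : E.action u = a at hs hk <;> cases hs <;>
    simp_all [Action.invocation, Action.response, WriterState.CanReturnAudit]

theorem hasMatchingResponse_of_audit {t : ℕ} (ht : E.action t = .auditInvoke)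
    (h : ∃ u, t < u ∧ ∃ EA, E.action u = .auditReturn EA) :
    E.HasMatchingResponse .writer .audit t := by
  classical
  obtain ⟨h1, EA, h2⟩ := Nat.find_spec h
  have hmin := fun u => Nat.find_min h (m := u)
  refine ⟨Nat.find h, h1, by rw [h2]; rfl, ?_⟩
  generalize Nat.find h = T at *
  have hphase : ∀ u, t + 1 ≤ u → u ≤ T → (E.state u).writer.phase = .auditing := by
    intro u hu
    induction u, hu using Nat.le_induction with
    | base =>
      intro _
      have hs := E.step t
      rw [ht] at hs
      generalize E.state (t + 1) = s' at hs ⊢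
      cases hs
      simp
    | succ u hu ih =>
      intro huT
      have ih := ih (by omega)
      have hmin := hmin u (by omega)
      rcases (E.step u).writer_cases with ⟨e, _⟩ | ⟨_, _, hid, _⟩ | ⟨_, hc, _⟩ | ⟨_, hid, _⟩ |
        ⟨EA, ha, hc, _⟩ | ⟨_, e, _⟩ | ⟨_, _, _, _, e, _⟩
      · rwa [e]
      · simp [ih] at hid
      · have := hc.2.1; simp [ih] at this
      · simp [ih] at hid
      · exact absurd ⟨by omega, EA, ha⟩ hmin
      · rwa [e]
      · rwa [e, (writerReceive_spec _ _ _).2.1]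
  intro u hu huT k'
  have hph := hphase u hu huT.le
  have hmin := hmin u huT
  have hs := E.step u
  generalize E.state (u + 1) = s' at hs
  constructor <;> intro hk <;> generalize ha : E.action u = a at hs hk <;> cases hs <;>
    simp_all [Action.invocation, Action.response, WriterState.CanReturnWrite]

/-! ### Termination of writes and audits -/

theorem not_crashed (hw : E.Correct .writer) (t : ℕ) : ¬ (E.state t).writer.crashed := by
  induction t with
  | zero => rw [E.start]; simp [initialState]
  | succ t ih =>
    rcases (E.step t).writer_cases with ⟨e, _⟩ | ⟨_, _, _, e, _⟩ | ⟨_, _, e, _⟩ | ⟨_, _, e, _⟩ |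
      ⟨_, _, _, e, _⟩ | ⟨ha, _⟩ | ⟨_, _, _, _, e, _⟩
    case inr.inr.inr.inr.inr.inl => exact absurd ha (hw t)
    all_goals rw [e]
    all_goals first | exact ih | rwa [(writerReceive_spec _ _ _).2.2.1]

theorem Admissible.exists_writeReturn (hE : E.Admissible) (hn : n = 3 * f + 1)
    (hF : F.servers.ncard ≤ f) (hw : E.Correct .writer) {t : ℕ} {v : V}
    (ht : E.action t = .writeInvoke v) : ∃ u, t < u ∧ E.action u = .writeReturn := by
  by_contra! hno
  set x := (E.state t).writer.ts + 1 with hx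
  set m : WriteMsg n V := ⟨x, generateBlocks n v⟩ with hm
  have hstart : ((E.state (t + 1)).writer.phase = .writing ∧ (E.state (t + 1)).writer.ts = x) ∧
      m ∈ (E.state (t + 1)).broadcasts := by
    have hs := E.step t
    rw [ht] at hs
    generalize E.state (t + 1) = s' at hs ⊢
    cases hs
    simp [hx, hm]
  have hphase : ∀ u, t + 1 ≤ u →
      (E.state u).writer.phase = .writing ∧ (E.state u).writer.ts = x := by
    intro u hu
    induction u, hu using Nat.le_induction with
    | base => exact hstart.1
    | succ u hu ih =>
      have hno := hno u (by omega)
      rcases (E.step u).writer_cases with ⟨e, _⟩ | ⟨_, _, hid, _⟩ | ⟨ha, _⟩ | ⟨_, hid, _⟩ |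
        ⟨_, _, hc, _⟩ | ⟨_, e, _⟩ | ⟨_, _, _, _, e, _⟩
      · rwa [e]
      · simp [ih] at hid
      · exact absurd ha hno
      · simp [ih] at hid
      · have := hc.2.1; simp [ih] at this
      · rwa [e]
      · rwa [e, (writerReceive_spec _ _ _).2.1, (writerReceive_spec _ _ _).1]
  have hack : ∀ i, i ∉ F.servers → ∀ᶠ u in atTop, (E.state u).writer.acks i = some x := by
    intro i hi
    obtain ⟨u, hu⟩ := hE.termination_one hw _ m hstart.2 i hi
    have hs := E.step u
    rw [hu] at hs
    have hb : m ∈ (E.state u).broadcasts ∧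
        ⟨.server i, .writer, .writeAck x⟩ ∈ (E.state (u + 1)).net := by
      generalize E.state (u + 1) = s' at hs ⊢
      cases hs
      exact ⟨‹_›, by simp [mem_packets, serverDeliver, hm]⟩
    -- `termination_one` gives no lower bound on the time of delivery. A delivery by time `t` would
    -- mean that `x` was broadcast before the counter reached it.
    have htu : t < u := by
      by_contra! hle
      have hmt : m ∈ (E.state t).broadcasts := Nat.le_induction hb.1
        (fun w _ hw => (E.step w).broadcasts_mono hw) t hle
      have := ((E.writeInvariant hn hF t).broadcast m hmt).2.1
      simp only [hm] at this
      omega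
    obtain ⟨w, hw1, hw2⟩ := hE.reliable_delivery _ _ hb.2 hi hw
    have hsw := E.step w
    rw [hw2] at hsw
    refine eventually_of_stable (t := w + 1) ?_ fun y hy ih => ?_
    · rw [hsw.receive_writer]
      simp [writerReceive, (hphase w (by omega)).2]
    · have hts := (hphase y (by omega)).2
      rcases (E.step y).writer_cases with ⟨e, _⟩ | ⟨_, _, _, e, _⟩ | ⟨_, _, e, _⟩ |
        ⟨_, _, e, _⟩ | ⟨_, _, _, e, _⟩ | ⟨_, e, _⟩ | ⟨src, m', _, _, e, _⟩ <;> rw [e] <;>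
        try exact ih
      -- The entry can only be overwritten by the writer's current timestamp, which is still `x`.
      rcases (writerReceive_spec (E.state y).writer src m').2.2.2 i with e | ⟨-, -, e⟩ <;> rw [e]
      · exact ih
      · rw [hts]
  obtain ⟨u, hu, hu'⟩ := hE.performed_of_eventually (a := .writeReturn) hw (t := t + 1) (by
    filter_upwards [eventually_correct hack, eventually_ge_atTop (t + 1)] with u hu hut
    refine ⟨not_crashed hw u, (hphase u hut).1, ?_⟩
    have := le_ncard_of_correct hn hF (A := {i | (E.state u).writer.acks i = some x}) hu
    rw [(hphase u hut).2]
    omega)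
  have := hno u (by omega)
  generalize E.action u = a at *
  cases a <;> simp_all [Action.task]

theorem Admissible.exists_auditReturn (hE : E.Admissible) (hn : n = 3 * f + 1)
    (hF : F.servers.ncard ≤ f) (hw : E.Correct .writer) {t : ℕ}
    (ht : E.action t = .auditInvoke) : ∃ u, t < u ∧ ∃ EA, E.action u = .auditReturn EA := by
  by_contra! hno
  have hstart : (E.state (t + 1)).writer.phase = .auditing ∧
      ∀ i, ⟨.writer, .server i, .auditReq⟩ ∈ (E.state (t + 1)).net := by
    have hs := E.step t
    rw [ht] at hs
    generalize E.state (t + 1) = s' at hs ⊢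
    cases hs
    simp [mem_packets, mem_toServers]
  have hphase : ∀ u, t + 1 ≤ u → (E.state u).writer.phase = .auditing := by
    intro u hu
    induction u, hu using Nat.le_induction with
    | base => exact hstart.1
    | succ u hu ih =>
      have hno := hno u (by omega)
      rcases (E.step u).writer_cases with ⟨e, _⟩ | ⟨_, _, hid, _⟩ | ⟨_, hc, _⟩ | ⟨_, hid, _⟩ |
        ⟨EA, ha, hc, _⟩ | ⟨_, e, _⟩ | ⟨_, _, _, _, e, _⟩
      · rwa [e]
      · simp [ih] at hid
      · have := hc.2.1; simp [ih] at this
      · simp [ih] at hid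
      · exact absurd ha (hno EA)
      · rwa [e]
      · rwa [e, (writerReceive_spec _ _ _).2.1]
  have hlog : ∀ i, i ∉ F.servers →
      ∀ᶠ u in atTop, (E.state u).writer.collectedLog i ≠ none := by
    intro i hi
    obtain ⟨u, hu1, hu2⟩ := hE.reliable_delivery _ _ (hstart.2 i) hw hi
    have hs := E.step u
    rw [hu2] at hs
    have hsent := (hs.receive_server hi).2 .writer
      (.auditResp ((E.state u).servers i).log) (by simp [serverReceive])
    obtain ⟨w, hw1, hw2⟩ := hE.reliable_delivery _ _ hsent hi hw
    have hsw := E.step w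
    rw [hw2] at hsw
    refine eventually_of_stable (t := w + 1) ?_ fun y hy ih => ?_
    · rw [hsw.receive_writer]
      simp [writerReceive]
    · have hph := hphase y (by omega)
      rcases (E.step y).writer_cases with ⟨e, _⟩ | ⟨_, _, _, e, _⟩ | ⟨_, _, e, _⟩ |
        ⟨_, hid, _⟩ | ⟨_, _, _, e, _⟩ | ⟨_, e, _⟩ | ⟨src, m', _, _, e, _⟩
      -- Only the invocation of another audit erases logs, and it requires an idle writer.
      case inr.inr.inr.inl => simp [hph] at hid
      all_goals rw [e]
      all_goals try exact ih
      unfold writerReceive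
      split <;> (try split) <;> (try exact ih)
      simp only [Function.update_apply]
      split
      · simp
      · exact ih
  obtain ⟨u, hu, hu'⟩ := hE.performed_of_eventually (a := .auditReturn) hw (t := t + 1) (by
    filter_upwards [eventually_correct hlog, eventually_ge_atTop (t + 1)] with u hu hut
    refine ⟨not_crashed hw u, hphase u hut, ?_⟩
    have := le_ncard_of_correct hn hF (A := {i | (E.state u).writer.collectedLog i ≠ none}) hu
    omega)
  have := hno u (by omega)
  generalize E.action u = a at *
  cases a <;> simp_all [Action.task]

variable {r : R} {k : ℤ} {t : ℕ}

/-! ### A read in progress -/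

/-- From time `t` on, the reader `r` is forever executing its read number `k`. -/
def Reading (E : Execution f F v₀) (r : R) (k : ℤ) (t : ℕ) : Prop :=
  ∀ u, t ≤ u → ((E.state u).readers r).nseq = k ∧ ((E.state u).readers r).phase ≠ .idle

/-- The read number changes only at an invocation, which needs the idle phase, and only a return
leads back to that phase. -/
theorem reading_of_no_return (ht : E.action t = .readInvoke r)
    (hno : ∀ u v, t < u → E.action u ≠ .readReturn r v) :
    ((E.state (t + 1)).readers r).phase = .collectTs ∧
    ((E.state (t + 1)).readers r).minTs = none ∧
    (∀ i, ⟨.reader r, .server i, .tsReq ((E.state (t + 1)).readers r).nseq⟩ ∈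
      (E.state (t + 1)).net) ∧
    E.Reading r ((E.state (t + 1)).readers r).nseq (t + 1) := by
  have hstart : ((E.state (t + 1)).readers r).phase = .collectTs ∧
      ((E.state (t + 1)).readers r).minTs = none ∧
      ∀ i, ⟨.reader r, .server i, .tsReq ((E.state (t + 1)).readers r).nseq⟩ ∈
        (E.state (t + 1)).net := by
    have hs := E.step t
    rw [ht] at hs
    generalize E.state (t + 1) = s' at hs ⊢
    cases hs
    simp [mem_packets, mem_toServers]
  refine ⟨hstart.1, hstart.2.1, hstart.2.2, fun u hu => ?_⟩
  induction u, hu using Nat.le_induction with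
  | base => simp [hstart.1]
  | succ u hu ih =>
    rcases (E.step u).reader_cases r with e | ⟨ha, _⟩ | ⟨-, -, e⟩ | ⟨v, ha, -⟩ |
      ⟨src, m, -, hp, e⟩
    · rwa [e]
    · have hs := E.step u
      rw [ha] at hs
      generalize E.state (u + 1) = s' at hs
      cases hs
      exact absurd ‹_› ih.2
    · rw [e]; exact ⟨ih.1, by simp⟩
    · exact absurd ha (hno u v (by omega))
    · rwa [e, readerReceive_phase, readerReceive_nseq]

/-- The steps of a reader in the middle of a read. -/
theorem Reading.step_cases (h : E.Reading r k t) {u : ℕ} (hu : t ≤ u) :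
    (E.state (u + 1)).readers r = (E.state u).readers r ∨
    (E.action u = .readBlocks r ∧ (∃ m, ((E.state u).readers r).CanGetBlocks f m) ∧
      (E.state (u + 1)).readers r = { (E.state u).readers r with phase := .collectBlocks }) ∨
    (∃ src m, E.action u = .receive ⟨src, .reader r, m⟩ ∧
      (E.state (u + 1)).readers r = (readerReceive f ((E.state u).readers r) src m).1) := by
  rcases (E.step u).reader_cases r with e | ⟨-, e⟩ | h' | ⟨v, -, e⟩ | ⟨src, m, ha, hp, e⟩
  · exact .inl e
  · have h1 := (h (u + 1) (by omega)).1
    rw [e, (h u hu).1] at h1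
    simp at h1
  · exact .inr (.inl h')
  · have := (h (u + 1) (by omega)).2
    simp [e] at this
  · exact .inr (.inr ⟨src, m, ha, e⟩)

theorem Reading.collectedTs_step (h : E.Reading r k t) {u : ℕ} (hu : t ≤ u) (i : Fin n) :
    ((E.state u).readers r).collectedTs i ⊆ ((E.state (u + 1)).readers r).collectedTs i := by
  rcases h.step_cases hu with e | ⟨-, -, e⟩ | ⟨src, m, -, e⟩ <;> rw [e]
  exact readerReceive_subset _ _ _ _

theorem Reading.collectedTs_mono (h : E.Reading r k t) {u w : ℕ} (hu : t ≤ u) (hw : u ≤ w)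
    (i : Fin n) :
    ((E.state u).readers r).collectedTs i ⊆ ((E.state w).readers r).collectedTs i := by
  induction w, hw using Nat.le_induction with
  | base => rfl
  | succ w hw ih => exact ih.trans (h.collectedTs_step (hu.trans hw) i)

theorem Reading.mono (h : E.Reading r k t) {u : ℕ} (hu : t ≤ u) : E.Reading r k u :=
  fun w hw => h w (hu.trans hw)

/-! ### Responses to the requests of a read -/

theorem Admissible.tsResp (hE : E.Admissible) (hr : r ∉ F.readers) {i : Fin n}
    (hi : i ∉ F.servers) (h : ⟨.reader r, .server i, .tsReq k⟩ ∈ (E.state t).net) :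
    ∃ u, t ≤ u ∧ ∃ x, E.action u = .receive ⟨.server i, .reader r, .tsResp x k⟩ := by
  obtain ⟨u, hu1, hu2⟩ := hE.reliable_delivery _ _ h hr hi
  have hs := E.step u
  rw [hu2] at hs
  have hsent := (hs.receive_server hi).2 (.reader r)
    (.tsResp ((E.state u).servers i).regTs k) (by simp [serverReceive])
  obtain ⟨w, hw1, hw2⟩ := hE.reliable_delivery _ _ hsent hi hr
  exact ⟨w, by omega, _, hw2⟩

/-- The request stays pending until served and is eventually enabled for good. As the read never
ends, the answer still bears the current number on arrival. -/
theorem Admissible.valResp (hE : E.Admissible) (hr : r ∉ F.readers) (h : E.Reading r k t)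
    {i : Fin n} (hi : i ∉ F.servers) {x : ℤ}
    (hreq : ⟨.reader r, .server i, .valReq x k⟩ ∈ (E.state t).net)
    (hx : ∀ᶠ u in atTop, x ≤ ((E.state u).servers i).regTs) :
    ∀ᶠ u in atTop, x ∈ ((E.state u).readers r).collectedTs i := by
  obtain ⟨u, hu1, hu2⟩ := hE.reliable_delivery _ _ hreq hr hi
  have hs := E.step u
  rw [hu2] at hs
  obtain ⟨w, hw1, hw2⟩ := hE.performed (a := .serveVal i (r, x, k)) hi (t := u + 1)
    (P := fun w => (r, x, k) ∈ ((E.state w).servers i).pendingVal)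
    (by simp [(hs.receive_server hi).1, serverReceive]) (by
      intro w hw hq
      rcases (E.step w).server_cases i with ⟨e, _⟩ | ⟨_, _, _, hp, e, _⟩ | ⟨_, _, _, e, _⟩ |
        ⟨q, rest, ha, hq', e, _⟩ | ⟨_, _, _, _, e, _⟩ <;> rw [e]
      · exact .inr hq
      · exact .inr (mem_serverReceive_pendingVal.2 (.inl hq))
      · exact .inr hq
      · rw [hq'] at hq
        rcases Multiset.mem_cons.1 hq with rfl | hq
        · rw [ha]; exact .inl rfl
        · exact .inr hq
      · exact .inr hq)
    (hx.mono fun w hw hq => ⟨hq, hw⟩)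
  have ha : E.action w = .serveVal i (r, x, k) := by
    generalize E.action w = a at *
    cases a <;> simp_all [Action.task]
  have hsent : ⟨.server i, .reader r, .valResp x k⟩ ∈ (E.state (w + 1)).net := by
    have hs := E.step w
    rw [ha] at hs
    generalize E.state (w + 1) = s' at hs ⊢
    cases hs
    simp [mem_packets]
  obtain ⟨y, hy1, hy2⟩ := hE.reliable_delivery _ _ hsent hi hr
  have hsy := E.step y
  rw [hy2] at hsy
  refine eventually_of_stable (t := y + 1) ?_ fun z hz hz' =>
    h.collectedTs_step (by omega) i hz'
  rw [(hsy.receive_reader hr).1]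
  simp [readerReceive, (h y (by omega)).1]

/-- Only the presence of a block is stable, since a later response could overwrite it; its timestamp
is controlled separately by `Reading.collectedBlocks_ts`. -/
theorem Admissible.blockResp (hE : E.Admissible) (hr : r ∉ F.readers) (h : E.Reading r k t)
    {i : Fin n} (hi : i ∉ F.servers) {x : ℤ}
    (hreq : ⟨.reader r, .server i, .blockReq ⟨r, r, x, k⟩⟩ ∈ (E.state t).net)
    (hx : ∀ᶠ u in atTop, x ≤ ((E.state u).servers i).regTs ∧
      ∃ b, (b, x) ∈ ((E.state u).servers i).val) :
    ∀ᶠ u in atTop, ((E.state u).readers r).collectedBlocks i ≠ none := by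
  obtain ⟨u, hu1, hu2⟩ := hE.reliable_delivery _ _ hreq hr hi
  have hs := E.step u
  rw [hu2] at hs
  obtain ⟨w, hw1, hw2⟩ := hE.performed (a := .serveBlock i ⟨r, r, x, k⟩) hi (t := u + 1)
    (P := fun w => ⟨r, r, x, k⟩ ∈ ((E.state w).servers i).pendingBlock)
    (by simp [(hs.receive_server hi).1, serverReceive]) (by
      intro w hw hq
      rcases (E.step w).server_cases i with ⟨e, _⟩ | ⟨_, _, _, hp, e, _⟩ | ⟨_, _, _, e, _⟩ |
        ⟨_, _, _, _, e, _⟩ | ⟨q, rest, ha, hq', e, _⟩ <;> rw [e]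
      · exact .inr hq
      · exact .inr (mem_serverReceive_pendingBlock.2 (.inl hq))
      · exact .inr hq
      · exact .inr hq
      · rw [hq'] at hq
        rcases Multiset.mem_cons.1 hq with rfl | hq
        · rw [ha]; exact .inl rfl
        · exact .inr hq)
    (hx.mono fun w hw hq => ⟨hq, hw⟩)
  have ha : E.action w = .serveBlock i ⟨r, r, x, k⟩ := by
    generalize E.action w = a at *
    cases a <;> simp_all [Action.task]
  obtain ⟨b, hsent⟩ : ∃ b, ⟨.server i, .reader r, .blockResp b x k⟩ ∈ (E.state (w + 1)).net := by
    have hs := E.step w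
    rw [ha] at hs
    generalize E.state (w + 1) = s' at hs ⊢
    cases hs with
    | serveBlock _ _ b => exact ⟨b, by simp [mem_packets]⟩
  obtain ⟨y, hy1, hy2⟩ := hE.reliable_delivery _ _ hsent hi hr
  have hsy := E.step y
  rw [hy2] at hsy
  refine eventually_of_stable (t := y + 1) ?_ fun z hz hz' => ?_
  · rw [(hsy.receive_reader hr).1]
    simp [readerReceive, (h y (by omega)).1]
  · rcases h.step_cases (u := z) (by omega) with e | ⟨-, -, e⟩ | ⟨src, m, -, e⟩ <;> rw [e]
    · exact hz'
    · exact hz'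
    · rcases readerReceive_collectedBlocks (f := f) ((E.state z).readers r) src m i with
        e | ⟨b, x, -, -, e⟩ <;> rw [e]
      · exact hz'
      · simp

/-! ### The first wait of a read -/

/-- The old minimum stays a candidate: it is still collected and still satisfies `NotOld`. -/
theorem Reading.minTs_step (hn : n = 3 * f + 1) (hF : F.servers.ncard ≤ f) (hr : r ∉ F.readers)
    (h : E.Reading r k t) {u : ℕ} (hu : t ≤ u) {m : ℤ}
    (hm : ((E.state u).readers r).minTs = some m) :
    ∃ m' ≤ m, ((E.state (u + 1)).readers r).minTs = some m' := by
  rcases h.step_cases hu with e | ⟨-, -, e⟩ | ⟨src, msg, -, e⟩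
  · rw [e]; exact ⟨m, le_rfl, hm⟩
  · rw [e]; exact ⟨m, le_rfl, hm⟩
  · have hsub := h.collectedTs_step hu
    rw [e] at hsub ⊢
    rcases readerReceive_minTs (f := f) ((E.state u).readers r) src msg with ⟨e', -⟩ | ⟨e', -⟩ <;>
      rw [e']
    · exact ⟨m, le_rfl, hm⟩
    · obtain ⟨⟨i, hi⟩, ho⟩ := (E.timestampInvariant hn hF hr u).minTs m hm
      obtain ⟨m', h1, h2⟩ := exists_leastNotOld_le (hsub i hi) (ho.mono hsub)
      exact ⟨m', h2, h1⟩

theorem Reading.valReq_sent (hr : r ∉ F.readers) (h : E.Reading r k t)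
    (ht : ((E.state t).readers r).minTs = none) {u : ℕ} (hu : t ≤ u) {m : ℤ}
    (hm : ((E.state u).readers r).minTs = some m) :
    ∃ w, t ≤ w ∧ ∀ i, ⟨.reader r, .server i, .valReq m k⟩ ∈ (E.state w).net := by
  induction u, hu using Nat.le_induction with
  | base => rw [ht] at hm; cases hm
  | succ u hu ih =>
    rcases h.step_cases hu with e | ⟨-, -, e⟩ | ⟨src, msg, ha, e⟩
    · rw [e] at hm; exact ih hm
    · rw [e] at hm; exact ih hm
    · have hs := E.step u
      rw [ha] at hs
      have hout := (hs.receive_reader hr).2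
      rw [e] at hm
      rcases readerReceive_minTs (f := f) ((E.state u).readers r) src msg with
        ⟨e', -⟩ | ⟨-, e', -⟩
      · rw [e'] at hm; exact ih hm
      · refine ⟨u + 1, by omega, fun i => hout _ _ ?_⟩
        rw [e' m hm, mem_toServers, (h u hu).1]
        exact ⟨rfl, i, rfl⟩

/-- A read eventually computes a minimal timestamp that some correct server has reached. -/
theorem Admissible.exists_minTs_le (hE : E.Admissible) (hn : n = 3 * f + 1)
    (hF : F.servers.ncard ≤ f) (hr : r ∉ F.readers) (h : E.Reading r k t)
    (hreq : ∀ i, ⟨.reader r, .server i, .tsReq k⟩ ∈ (E.state t).net) :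
    ∃ u, t ≤ u ∧ ∃ m, ((E.state u).readers r).minTs = some m ∧
      ∃ j, j ∉ F.servers ∧ m ≤ ((E.state u).servers j).regTs := by
  classical
  choose! τ hτ x hx using fun i (hi : i ∉ F.servers) => hE.tsResp hr hi (hreq i)
  have hne : (Finset.univ.filter (· ∉ F.servers)).Nonempty := by
    obtain ⟨i, -, hi⟩ := exists_correct_of_lt_ncard hF (A := Set.univ)
      (by rw [Set.ncard_univ, Nat.card_eq_fintype_card, Fintype.card_fin]; omega)
    exact ⟨i, by simpa using hi⟩
  -- Among the correct servers, `l` is the one whose answer arrives last, and `j` the one reporting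
  -- the largest timestamp. After `τ l`, all correct servers witness `NotOld` for `x j`.
  obtain ⟨l, hl, hlmax⟩ := Finset.exists_max_image _ τ hne
  obtain ⟨j, hj, hjmax⟩ := Finset.exists_max_image _ x hne
  simp only [Finset.mem_filter, Finset.mem_univ, true_and] at hl hlmax hj hjmax
  have hC : ∀ i, i ∉ F.servers →
      x i ∈ ((E.state (τ l + 1)).readers r).collectedTs i := by
    intro i hi
    refine h.collectedTs_mono (u := τ i + 1) (by have := hτ i hi; omega)
      (by have := hlmax i hi; omega) i ?_
    have hs := E.step (τ i)
    rw [hx i hi] at hs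
    rw [(hs.receive_reader hr).1]
    simp only [readerReceive, (h _ (hτ i hi)).1, if_true]
    split <;> simp
  have hold : NotOld f ((E.state (τ l + 1)).readers r).collectedTs (x j) :=
    le_ncard_of_correct hn hF fun i hi => finset_min_le_iff.2 ⟨x i, hC i hi, hjmax i hi⟩
  obtain ⟨m, hm, hmx⟩ := exists_leastNotOld_le (hC j hj) hold
  refine ⟨τ l + 1, by have := hτ l hl; omega, m, ?_, j, hj,
    hmx.trans ((E.timestampInvariant hn hF hr _).collectedTs j hj _ (hC j hj)).2⟩
  have hs := E.step (τ l)
  rw [hx l hl] at hs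
  -- With `2f + 1 = n - f` non-empty sets, the reception at time `τ l` does trigger the
  -- recomputation.
  have hcard := le_ncard_of_correct hn hF
    (A := {i | ((E.state (τ l + 1)).readers r).collectedTs i ≠ ∅})
    fun i hi => Finset.ne_empty_of_mem (hC i hi)
  rw [← (h _ (hτ l hl)).1] at hs
  rw [(hs.receive_reader hr).1] at hm hcard ⊢
  rw [← hm]
  exact readerReceive_tsResp_minTs _ _ _ (by omega)

theorem Admissible.exists_readBlocks (hE : E.Admissible) (hn : n = 3 * f + 1)
    (hF : F.servers.ncard ≤ f) (hr : r ∉ F.readers) (h : E.Reading r k t)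
    (hph : ((E.state t).readers r).phase = .collectTs)
    (hmin : ((E.state t).readers r).minTs = none)
    (hreq : ∀ i, ⟨.reader r, .server i, .tsReq k⟩ ∈ (E.state t).net) :
    ∃ u, t ≤ u ∧ E.action u = .readBlocks r := by
  by_contra! hno
  have hphase : ∀ u, t ≤ u → ((E.state u).readers r).phase = .collectTs := by
    intro u hu
    induction u, hu using Nat.le_induction with
    | base => exact hph
    | succ u hu ih =>
      rcases h.step_cases hu with e | ⟨ha, -⟩ | ⟨src, msg, ha, e⟩
      · rwa [e]
      · exact absurd ha (hno u hu)
      · rwa [e, readerReceive_phase]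
  obtain ⟨T, hT, m, hm, j, hj, hmj⟩ := hE.exists_minTs_le hn hF hr h hreq
  have hnonneg : ∀ u m, ((E.state u).readers r).minTs = some m → 0 ≤ m := fun u m hm =>
    have I := E.timestampInvariant hn hF hr u
    (I.minTs m hm).2.nonneg hF fun i hi t ht => (I.collectedTs i hi t ht).1
  -- The least value that `minTs` ever takes in this read. Since `minTs` never increases, it stays
  -- at `M` once there, and `M ≤ m` keeps it within the reach of server `j`.
  obtain ⟨M, ⟨w, hw, hM⟩, hMmin⟩ := Int.exists_least_of_bdd
    (P := fun m => ∃ u, t ≤ u ∧ ((E.state u).readers r).minTs = some m)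
    ⟨0, fun m ⟨u, _, hu⟩ => hnonneg u m hu⟩ ⟨m, T, hT, hm⟩
  have hMj : M ≤ ((E.state T).servers j).regTs := (hMmin m ⟨T, hT, hm⟩).trans hmj
  have hstable : ∀ᶠ u in atTop, ((E.state u).readers r).minTs = some M := by
    refine eventually_of_stable hM fun u hu hu' => ?_
    obtain ⟨m', hle, hm'⟩ := h.minTs_step hn hF hr (hw.trans hu) hu'
    rw [hm', le_antisymm hle (hMmin m' ⟨u + 1, by omega, hm'⟩)]
  obtain ⟨y, hy, hsent⟩ := h.valReq_sent hr hmin hw hM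
  have hresp : ∀ i, i ∉ F.servers →
      ∀ᶠ u in atTop, M ∈ ((E.state u).readers r).collectedTs i := fun i hi =>
    hE.valResp hr (h.mono hy) hi (hsent i)
      ((hE.eventually_block hn hF hj hi (hnonneg w M hM) hMj).mono fun _ h => h.1)
  obtain ⟨u, hu, hu'⟩ := hE.performed_of_eventually (a := .readBlocks r) hr (t := t) (by
    filter_upwards [eventually_correct hresp, hstable, eventually_ge_atTop t] with u hu hu' hut
    refine ⟨M, hphase u hut, hu', ?_⟩
    have := le_ncard_of_correct hn hF
      (A := {i | M ∈ ((E.state u).readers r).collectedTs i}) hu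
    omega)
  have := hno u hu
  generalize E.action u = a at *
  cases a <;> simp_all [Action.task]

/-! ### The second wait of a read -/

/-- One read issues a single round of block requests, so correct servers can answer only for `μ`.
Later changes of `minTs` have no effect on it. -/
theorem Reading.collectedBlocks_ts (hr : r ∉ F.readers) (h : E.Reading r k t) {μ : ℤ}
    (hc : ((E.state t).readers r).CanGetBlocks f μ) (ha : E.action t = .readBlocks r) {u : ℕ}
    (hu : t + 1 ≤ u) :
    ((E.state u).readers r).phase = .collectBlocks ∧
    (∀ i, i ∉ F.servers → ∀ x, BlockTrace (E.state u) r i x k → x = μ) ∧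
    ∀ i, i ∉ F.servers → ∀ b x,
      ((E.state u).readers r).collectedBlocks i = some (b, x) → x = μ := by
  induction u, hu using Nat.le_induction with
  | base =>
    have I := E.blockInvariant hr t
    have hs := E.step t
    rw [ha] at hs
    have hst : (E.state (t + 1)).readers r =
        { (E.state t).readers r with phase := .collectBlocks } := by
      generalize E.state (t + 1) = s' at hs ⊢
      cases hs
      simp
    refine ⟨by rw [hst], fun i hi x T => ?_, fun i hi b x hb => ?_⟩
    · rcases T.of_step hr hi hs with T | ⟨-, hc', -⟩
      -- A trace older than this step would contradict the phase `collectTs` at time `t`.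
      · exact absurd hc.1 ((I.trace i hi x k T).2 (h t le_rfl).1.symm)
      · have := hc'.2.1.symm.trans hc.2.1
        simpa using this
    · rw [hst] at hb
      have := I.not_collected hc.1 i hi
      simp only at hb
      rw [this] at hb
      cases hb
  | succ u hu ih =>
    obtain ⟨ih1, ih2, ih3⟩ := ih
    have hu' : t ≤ u := by omega
    refine ⟨?_, fun i hi x T => ?_, fun i hi b x hb => ?_⟩
    · rcases h.step_cases hu' with e | ⟨-, -, e⟩ | ⟨src, msg, ha, e⟩ <;> rw [e]
      · exact ih1
      · rwa [readerReceive_phase]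
    · rcases T.of_step hr hi (E.step u) with T | ⟨-, hc', -⟩
      · exact ih2 i hi x T
      · have := hc'.1
        rw [ih1] at this
        cases this
    · rcases (E.step u).reader_cases r with e | ⟨-, e⟩ | ⟨-, -, e⟩ | ⟨-, -, e⟩ |
        ⟨src, m, -, hp, e⟩ <;> rw [e] at hb
      · exact ih3 i hi b x hb
      · cases hb
      · exact ih3 i hi b x hb
      · exact ih3 i hi b x hb
      · rcases readerReceive_collectedBlocks (f := f) ((E.state u).readers r) src m i with
          e' | ⟨b', x', rfl, rfl, e'⟩ <;> rw [e'] at hb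
        · exact ih3 i hi b x hb
        · cases hb
          rw [(h u hu').1] at hp
          exact ih2 i hi _ (.response _ hp)

/-- When the reader has a block from every correct server, it has a value to return. -/
theorem exists_isGetValue (hn : n = 3 * f + 1) (hF : F.servers.ncard ≤ f)
    (W : WriteInvariant F v₀ s) (I : BlockInvariant F r s) {μ : ℤ}
    (hne : ∀ i, i ∉ F.servers → (s.readers r).collectedBlocks i ≠ none)
    (hμ : ∀ i, i ∉ F.servers → ∀ b x, (s.readers r).collectedBlocks i = some (b, x) → x = μ) :
    ∃ v, IsGetValue f (s.readers r).collectedBlocks v μ := by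
  have hblock : ∀ i, i ∉ F.servers → ∃ b, (s.readers r).collectedBlocks i = some (b, μ) ∧
      (b, μ) ∈ (s.servers i).val := by
    intro i hi
    obtain ⟨⟨b, x⟩, hb⟩ := Option.ne_none_iff_exists'.1 (hne i hi)
    obtain rfl := hμ i hi b x hb
    exact ⟨b, hb, I.collected i hi b _ hb⟩
  obtain ⟨j, -, hj⟩ := exists_correct_of_lt_ncard hF (A := Set.univ)
    (by rw [Set.ncard_univ, Nat.card_eq_fintype_card, Fintype.card_fin]; omega)
  obtain ⟨b₀, -, hb₀⟩ := hblock j hj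
  refine ⟨b₀.value, le_ncard_of_correct hn hF fun i hi => ?_, fun v' x' hrec => ?_⟩
  · obtain ⟨b, hb, hb'⟩ := hblock i hi
    rw [Set.mem_ofPred_eq, hb, W.value_unique hb' hb₀]
  -- Byzantine positions alone cannot reconstruct a pair with a higher timestamp: one of the `2f +
  -- 1` positions is correct and holds `μ`.
  · obtain ⟨i, hi, hi'⟩ := exists_correct_of_lt_ncard hF (le_trans (by omega) hrec)
    exact (hμ i hi' _ _ hi).le

theorem Admissible.exists_readReturn (hE : E.Admissible) (hn : n = 3 * f + 1)
    (hF : F.servers.ncard ≤ f) (hr : r ∉ F.readers) (ht : E.action t = .readInvoke r) :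
    ∃ u v, t < u ∧ E.action u = .readReturn r v := by
  by_contra! hno
  obtain ⟨hph, hmin, hreq, h⟩ := reading_of_no_return ht hno
  obtain ⟨T, hT, ha⟩ := hE.exists_readBlocks hn hF hr h hph hmin hreq
  generalize ((E.state (t + 1)).readers r).nseq = k at *
  obtain ⟨μ, hc, hsent⟩ : ∃ μ, ((E.state T).readers r).CanGetBlocks f μ ∧
      ∀ i, ⟨.reader r, .server i, .blockReq ⟨r, r, μ, k⟩⟩ ∈ (E.state (T + 1)).net := by
    have hk := (h T hT).1
    have hs := E.step T
    rw [ha] at hs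
    generalize E.state (T + 1) = s' at hs ⊢
    cases hs with
    | readBlocks _ m _ hc => exact ⟨m, hc, by simp [mem_packets, mem_toServers, hk]⟩
  have I := E.timestampInvariant hn hF hr T
  obtain ⟨j, hjμ, hj⟩ := exists_correct_of_lt_ncard hF hc.2.2
  obtain ⟨h0, hjμ⟩ := I.collectedTs j hj μ hjμ
  have hold := (I.minTs μ hc.2.1).2
  have hresp : ∀ i, i ∉ F.servers →
      ∀ᶠ u in atTop, ((E.state u).readers r).collectedBlocks i ≠ none := fun i hi =>
    hE.blockResp hr (h.mono (by omega)) hi (hsent i) (hE.eventually_block hn hF hj hi h0 hjμ)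
  obtain ⟨u, hu, hu'⟩ := hE.performed_of_eventually (a := .readReturn r) hr (t := t + 1) (by
    filter_upwards [eventually_correct hresp, eventually_ge_atTop (T + 1)] with u hu hut
    obtain ⟨h1, -, h3⟩ := (h.mono hT).collectedBlocks_ts hr hc ha hut
    obtain ⟨v, hv⟩ := exists_isGetValue hn hF (E.writeInvariant hn hF u)
      (E.blockInvariant hr u) hu h3
    exact ⟨v, μ, h1, hv, hold.mono (h.collectedTs_mono hT (by omega))⟩)
  have := fun v => hno u v (by omega)
  generalize E.action u = a at *
  cases a <;> simp_all [Action.task]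

end Execution

end AuditableRegister

/-! ### Wait-freedom from the three kinds of operations -/

theorem mainTheorem3 {R V : Type*} (n f : ℕ) (hn : n = 3 * f + 1)
    (F : AuditableRegister.Faults n R) (hF : F.servers.ncard ≤ f) (v₀ : V)
    (E : AuditableRegister.Execution f F v₀) (hE : E.Admissible) :
    (∀ r : R, E.Correct (.reader r) → ∀ t : ℕ, E.action t = .readInvoke r →
      E.HasMatchingResponse (.reader r) .read t) ∧
    (E.Correct .writer → ∀ (t : ℕ) (v : V), E.action t = .writeInvoke v →
      E.HasMatchingResponse .writer .write t) ∧
    E.WaitFree := by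
  have hread : ∀ r : R, E.Correct (.reader r) → ∀ t : ℕ, E.action t = .readInvoke r →
      E.HasMatchingResponse (.reader r) .read t := fun r hr t ht =>
    AuditableRegister.Execution.hasMatchingResponse_of_reader ht
      (hE.exists_readReturn hn hF hr ht)
  have hwrite : E.Correct .writer → ∀ (t : ℕ) (v : V), E.action t = .writeInvoke v →
      E.HasMatchingResponse .writer .write t := fun hw t v ht =>
    AuditableRegister.Execution.hasMatchingResponse_of_write ht
      (hE.exists_writeReturn hn hF hw ht)
  refine ⟨hread, hwrite, fun t p k hp hk => ?_⟩
  cases ha : E.action t <;> rw [ha] at hk <;>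
    simp only [AuditableRegister.Action.invocation, Option.some.injEq, Prod.mk.injEq,
      reduceCtorEq] at hk
  · obtain ⟨rfl, rfl⟩ := hk
    exact hread _ hp t ha
  · obtain ⟨rfl, rfl⟩ := hk
    exact hwrite hp t _ ha
  · obtain ⟨rfl, rfl⟩ := hk
    exact AuditableRegister.Execution.hasMatchingResponse_of_audit ha
      (hE.exists_auditReturn hn hF hp ha)
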